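/- For $p\in\mathbb{C}$ with $|p|<1$ and $z\in\mathbb{C}\setminus\{0\}$ let $$\theta(z;p)=\prod_{j=0}^{\infty}(1-zp^j)(1-p^{j+1}/z),\qquad (x;q,p)_k=\prod_{j=0}^{k-1}\theta(xq^j;p),\qquad (x_1,\dots,x_s;q,p)_k=(x_1;q,p)_k\cdots(x_s;q,p)_k,$$ and define the (terminating) very-well-poised elliptic hypergeometric series $${}_{r+1}V_r(a_1;a_6,\dots,a_{r+1};q,p)=\sum_{k=0}^{\infty}\frac{\theta(a_1q^{2k};p)}{\theta(a_1;p)}\,\frac{(a_1,a_6,\dots,a_{r+1};q,p)_k\,q^k}{(q,a_1q/a_6,\dots,a_1q/a_{r+1};q,p)_k}.$$ **Theorem 4.2.** Let $n$ be a nonnegative integer, let $a,b,c,k,q,p$ be nonzero complex numbers with $|p|<1$, and put $m=bck/(aq)$ and $d=\pm m(q/a)^{1/2}$, for any choice of the sign and of the square roots $(q/a)^{1/2}$ and $p^{1/2}$. Then $$\begin{aligned} &{}_{14}V_{13}(a;a^2/m^2,b,bq,c,cq,kq^n,kq^{n+1},q^{-n},q^{1-n};q^2,p)\\ &\quad=\frac{(aq,k/m,mq/b,mq/c;q,p)_n}{(mq,k/a,aq/b,aq/c;q,p)_n}\;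 {}_{14}V_{13}(m;a/m,d,-d,dp^{1/2},-d/p^{1/2},b,c,kq^n,q^{-n};q,p), \end{aligned}$$ provided that no denominator in this identity vanishes, that is, in the prefactor, in the terms of index $0,\dots,\lfloor n/2\rfloor$ of the series on the left, and in the terms of index $0,\dots,n$ of the series on the right (all later terms are taken to be zero, as their numerators contain the factor $\theta(1;p)=0$). -/

import Mathlib

namespace EllHyp

noncomputable section

/-- The modified Jacobi theta function `θ(z;p) = ∏_{j ≥ 0} (1 - z p^j) (1 - p^(j+1) / z)`,
used for `z ≠ 0` and `|p| < 1`, where the product converges absolutely. -/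
def theta (z p : ℂ) : ℂ := ∏' j : ℕ, (1 - z * p ^ j) * (1 - p ^ (j + 1) / z)

/-- The elliptic shifted factorial `(a;q,p)_n = ∏_{j < n} θ(a q^j; p)`. -/
def ellFac (a q p : ℂ) (n : ℕ) : ℂ := ∏ j ∈ Finset.range n, theta (a * q ^ j) p

/-- The condensed notation `(a₁,…,a_s;q,p)_n = (a₁;q,p)_n ⋯ (a_s;q,p)_n`. -/
def ellFacs (l : List ℂ) (q p : ℂ) (n : ℕ) : ℂ := (l.map fun x => ellFac x q p n).prod

/-- The product `(q, a q/x₁, …, a q/x_s; q, p)_k` in the denominator of the `k`-th term of a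
very-well-poised elliptic hypergeometric series with parameters `x₁, …, x_s`. -/
def seriesDenom (a : ℂ) (l : List ℂ) (q p : ℂ) (k : ℕ) : ℂ :=
  ellFacs (q :: l.map fun x => a * q / x) q p k

/-- The very-well-poised elliptic hypergeometric series
`V(a; x₁, …, x_s; q, p) = ∑_{k ≥ 0} θ(a q^(2k);p)/θ(a;p) *
  (a, x₁, …, x_s; q, p)_k q^k / (q, a q/x₁, …, a q/x_s; q, p)_k`.
With `s` listed parameters it is traditionally labelled `_{r+1}V_r`, `r + 1 = s + 5`
(so nine listed parameters give `₁₄V₁₃`).  It is used for terminating series only. -/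
def V (a : ℂ) (l : List ℂ) (q p : ℂ) : ℂ :=
  ∑' k : ℕ, theta (a * q ^ (2 * k)) p / theta a p *
    (ellFacs (a :: l) q p k * q ^ k / seriesDenom a l q p k)

/-- No denominator vanishes in the terms `k = 0, …, N` of `V(a; l; q, p)`. -/
def TermsDefined (a : ℂ) (l : List ℂ) (q p : ℂ) (N : ℕ) : Prop :=
  theta a p ≠ 0 ∧ ∀ k ≤ N, seriesDenom a l q p k ≠ 0

end

end EllHyp

open Filter Topology

namespace EllHyp

/-! The transformation is an elliptic Bailey-type argument: the left-hand series is turned into a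
double sum by one use of the Frenkel–Turaev sum, the order of summation is exchanged, and the new
inner sum is evaluated by the same summation in base `q ^ 2`.

Since `m a q = b c k`, the terminating series in base `q` with parameters `m q^(4j); b q^(2j), c
q^(2j), k q^(n+2j), m/a, q^(2j-n)` is balanced. Its closed form, multiplied by the prefactor of the
theorem, is the product that relates the `j`-th term on the left to its expansion in `s = 2j + i`.
For generic parameters that closed form is nonzero and can be cancelled, so the `j`-th term equals
the prefactor times `∑_{s ≥ 2j} outerTerm s * innerTerm s j`. For fixed `s` the sum over `j` is
very-well-poised in base `q ^ 2`, with parameters `a²/m², m q^s, m q^(s+1), q^(-s), q^(1-s)`. One of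
the last two terminates it, according to the parity of `s`, and both parities give `innerSum`. The
factors of `innerSum` in base `q ^ 2` become the four parameters `±d, d p^(1/2), -d/p^(1/2)` by the
duplication formula for theta.

The Frenkel–Turaev sum itself (`sum_ftTerm`) is proved by induction on its length: terms and closed
form satisfy the same contiguous relation, and both relations are instances of the Weierstrass
addition formula. The latter is derived from the Jacobi triple product. Sorting a product of two
theta series by parity writes `θ(xy)θ(x/y)` as a 2×2 determinant, and the addition formula is the
Plücker relation between such determinants.

Cancellation and the inner summations need more nonvanishing than the theorem assumes. The
parameters are therefore moved along a one-parameter path respecting the constraints on `m` and `d`.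
All but countably many real points of the path are generic, and both sides are continuous at the
original point because no denominator vanishes there. -/

/-- The infinite `p`-shifted factorial `(z;p)_∞`. -/
noncomputable def pochInf (z p : ℂ) : ℂ := ∏' j : ℕ, (1 - z * p ^ j)

/-! ### Infinite products and elementary identities for theta -/

theorem summable_norm_mul_pow (z : ℂ) {p : ℂ} (hp : ‖p‖ < 1) :
    Summable fun j : ℕ => ‖-(z * p ^ j)‖ := by
  simp only [norm_neg, norm_mul, norm_pow]
  exact (summable_geometric_of_lt_one (norm_nonneg p) hp).mul_left _

theorem multipliable_pochInf (z : ℂ) {p : ℂ} (hp : ‖p‖ < 1) :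
    Multipliable fun j : ℕ => 1 - z * p ^ j := by
  simpa only [sub_eq_add_neg] using multipliable_one_add_of_summable (summable_norm_mul_pow z hp)

theorem theta_eq_pochInf (z : ℂ) {p : ℂ} (hp : ‖p‖ < 1) :
    theta z p = pochInf z p * pochInf (p / z) p := by
  have h : ∀ j : ℕ, p ^ (j + 1) / z = p / z * p ^ j := fun j => by ring
  simp only [theta, pochInf, h]
  exact (multipliable_pochInf z hp).tprod_mul (multipliable_pochInf _ hp)

theorem pochInf_eq (z : ℂ) {p : ℂ} (hp : ‖p‖ < 1) :
    pochInf z p = (1 - z) * pochInf (p * z) p := by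
  have h : ∀ j : ℕ, 1 - p * z * p ^ j = 1 - z * p ^ (j + 1) := fun j => by ring
  have h2 : Multipliable fun j : ℕ => 1 - z * p ^ (j + 1) :=
    (multipliable_pochInf (p * z) hp).congr h
  have h3 := tprod_eq_zero_mul' (f := fun j : ℕ => 1 - z * p ^ j) h2
  rw [pow_zero, mul_one] at h3
  rw [pochInf, h3, pochInf, tprod_congr h]

theorem pochInf_ne_zero {z p : ℂ} (hp : ‖p‖ < 1) (h : ∀ j : ℕ, z * p ^ j ≠ 1) :
    pochInf z p ≠ 0 := by
  have := tprod_one_add_ne_zero_of_summable (f := fun j : ℕ => -(z * p ^ j))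
    (fun j => by rw [← sub_eq_add_neg]; exact sub_ne_zero.2 (h j).symm) (summable_norm_mul_pow z hp)
  simpa only [← sub_eq_add_neg, pochInf] using this

theorem pochInf_self_ne_zero {p : ℂ} (hp : ‖p‖ < 1) : pochInf p p ≠ 0 := by
  refine pochInf_ne_zero hp fun j h => ?_
  have h2 : ‖p‖ ^ (j + 1) = 1 := by
    rw [← norm_pow, pow_succ', h, norm_one]
  exact (pow_lt_one₀ (norm_nonneg p) hp (Nat.succ_ne_zero j)).ne h2

/-- Removing the first factor from each of the two infinite products leaves `(pz;p)_∞ (p/z;p)_∞`,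
which is symmetric under inversion. Only `(1 - 1/z) = -(1 - z)/z` remains. -/
theorem theta_inv {z p : ℂ} (hz : z ≠ 0) (hp : ‖p‖ < 1) : theta z⁻¹ p = -theta z p / z := by
  rw [theta_eq_pochInf _ hp, theta_eq_pochInf _ hp, pochInf_eq z hp, pochInf_eq z⁻¹ hp,
    ← div_eq_mul_inv, div_inv_eq_mul]
  field_simp
  ring

theorem theta_mul_nome {z p : ℂ} (hz : z ≠ 0) (hp0 : p ≠ 0) (hp : ‖p‖ < 1) :
    theta (p * z) p = -theta z p / z := by
  rw [theta_eq_pochInf _ hp, theta_eq_pochInf _ hp, pochInf_eq z hp,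
    show p / (p * z) = z⁻¹ by field_simp, pochInf_eq z⁻¹ hp, ← div_eq_mul_inv]
  field_simp
  ring

theorem theta_one {p : ℂ} (hp : ‖p‖ < 1) : theta 1 p = 0 := by
  rw [theta_eq_pochInf _ hp, pochInf_eq 1 hp]
  simp

/-- A convergent infinite product vanishes only through one of its factors. The zeros thus lie in a
countable set, which is what makes almost every parameter generic later. -/
theorem exists_zpow_of_theta_eq_zero {z p : ℂ} (hz : z ≠ 0) (hp : ‖p‖ < 1)
    (h : theta z p = 0) : ∃ l : ℤ, z = p ^ l := by
  rw [theta_eq_pochInf _ hp, mul_eq_zero] at h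
  rcases h with h | h
  · have : ∃ j : ℕ, z * p ^ j = 1 := by
      by_contra! h'
      exact pochInf_ne_zero hp h' h
    obtain ⟨j, hj⟩ := this
    refine ⟨-j, ?_⟩
    rw [zpow_neg, zpow_natCast]
    exact eq_inv_of_mul_eq_one_left hj
  · have : ∃ j : ℕ, p / z * p ^ j = 1 := by
      by_contra! h'
      exact pochInf_ne_zero hp h' h
    obtain ⟨j, hj⟩ := this
    refine ⟨(j + 1 : ℕ), ?_⟩
    rw [zpow_natCast, pow_succ']
    field_simp at hj
    exact hj.symm

theorem pochInf_eq_even_mul_odd (z : ℂ) {p : ℂ} (hp : ‖p‖ < 1) :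
    pochInf z p = pochInf z (p ^ 2) * pochInf (z * p) (p ^ 2) := by
  have hp2 : ‖p ^ 2‖ < 1 := by
    rw [norm_pow]
    exact pow_lt_one₀ (norm_nonneg p) hp two_ne_zero
  have he : ∀ j : ℕ, 1 - z * p ^ (2 * j) = 1 - z * (p ^ 2) ^ j := fun j => by rw [pow_mul]
  have ho : ∀ j : ℕ, 1 - z * p ^ (2 * j + 1) = 1 - z * p * (p ^ 2) ^ j := fun j => by
    rw [pow_succ, pow_mul]; ring
  have := tprod_even_mul_odd (f := fun j : ℕ => 1 - z * p ^ j)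
    (by simpa only [he] using multipliable_pochInf z hp2)
    (by simpa only [ho] using multipliable_pochInf (z * p) hp2)
  simp only [he, ho] at this
  exact this.symm

theorem pochInf_mul_pochInf_neg (z : ℂ) {p : ℂ} (hp : ‖p‖ < 1) :
    pochInf z p * pochInf (-z) p = pochInf (z ^ 2) (p ^ 2) := by
  rw [pochInf, pochInf, ← (multipliable_pochInf z hp).tprod_mul (multipliable_pochInf (-z) hp),
    pochInf]
  congr 1
  ext j
  ring

/-- Duplication formula for the theta function, with `s` a square root of the nome `p`. -/
theorem theta_sq {z p s : ℂ} (hz : z ≠ 0) (hs0 : s ≠ 0) (hp : ‖p‖ < 1) (hs : s ^ 2 = p) :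
    theta (z ^ 2) p = theta z p * theta (-z) p * (theta (z * s) p * theta (-(z * s)) p) := by
  -- This is `θ(w;p) θ(-w;p) = θ(w²;p²)`, used at `w = z` and `w = z s`. Splitting the factors of
  -- `θ(z²;p)` by the parity of the index gives the product of the two results.
  have key : ∀ w : ℂ, theta w p * theta (-w) p =
      pochInf (w ^ 2) (p ^ 2) * pochInf (p ^ 2 / w ^ 2) (p ^ 2) := fun w => by
    rw [theta_eq_pochInf _ hp, theta_eq_pochInf _ hp, ← pochInf_mul_pochInf_neg w hp,
      ← div_pow, ← pochInf_mul_pochInf_neg (p / w) hp, div_neg]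
    ring
  rw [key, key, theta_eq_pochInf _ hp, pochInf_eq_even_mul_odd _ hp,
    pochInf_eq_even_mul_odd (p / z ^ 2) hp, mul_pow, hs,
    show p ^ 2 / (z ^ 2 * p) = p / z ^ 2 by subst hs; field_simp,
    show p / z ^ 2 * p = p ^ 2 / z ^ 2 by ring]
  ring

/-- On a compact set bounded by `R`, the geometric series `R ‖p‖^j` dominates, so the product
converges locally uniformly. -/
theorem continuous_pochInf {p : ℂ} (hp : ‖p‖ < 1) : Continuous fun z => pochInf z p := by
  have h : HasProdLocallyUniformlyOn (fun (j : ℕ) (z : ℂ) => 1 + -(z * p ^ j))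
      (fun z => ∏' j : ℕ, (1 + -(z * p ^ j))) Set.univ := by
    apply hasProdLocallyUniformlyOn_of_forall_compact isOpen_univ
    intro K _ hK
    obtain ⟨R, hR⟩ := hK.isBounded.exists_norm_le
    have hsum : Summable fun j : ℕ => R * ‖p‖ ^ j :=
      (summable_geometric_of_lt_one (norm_nonneg p) hp).mul_left R
    refine hsum.hasProdUniformlyOn_nat_one_add hK (Eventually.of_forall fun j z hz => ?_)
      (fun j => by fun_prop)
    rw [norm_neg, norm_mul, norm_pow]
    exact mul_le_mul_of_nonneg_right (hR z hz) (by positivity)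
  have h2 := h.continuousOn (Frequently.of_forall fun s => by fun_prop)
  rw [← continuousOn_univ]
  simpa only [← sub_eq_add_neg, pochInf] using h2

theorem continuousAt_theta {z p : ℂ} (hz : z ≠ 0) (hp : ‖p‖ < 1) :
    ContinuousAt (fun z => theta z p) z := by
  simp only [fun z => theta_eq_pochInf z hp]
  exact (continuous_pochInf hp).continuousAt.mul
    (ContinuousAt.comp (f := fun z => p / z) (continuous_pochInf hp).continuousAt
      (continuousAt_const.div continuousAt_id hz))

/-! ### The Jacobi triple product and the addition formula -/

/-- The Gaussian binomial coefficient, through its Pascal recursion. -/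
noncomputable def gaussBinom (p : ℂ) : ℕ → ℕ → ℂ
  | _, 0 => 1
  | 0, _ + 1 => 0
  | n + 1, i + 1 => p ^ (i + 1) * gaussBinom p n (i + 1) + gaussBinom p n i

/-- The finite `p`-factorial `(p;p)_n`. -/
noncomputable def pochSelf (p : ℂ) (n : ℕ) : ℂ := ∏ j ∈ Finset.range n, (1 - p * p ^ j)

theorem gaussBinom_zero_right (p : ℂ) (n : ℕ) : gaussBinom p n 0 = 1 := by
  cases n <;> rfl

theorem gaussBinom_eq_zero (p : ℂ) {n i : ℕ} (h : n < i) : gaussBinom p n i = 0 := by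
  induction n generalizing i with
  | zero => cases i with
    | zero => omega
    | succ i => rfl
  | succ n ih => cases i with
    | zero => omega
    | succ i => rw [gaussBinom, ih (by omega), ih (by omega)]; ring

theorem gaussBinom_self (p : ℂ) (n : ℕ) : gaussBinom p n n = 1 := by
  induction n with
  | zero => rfl
  | succ n ih => rw [gaussBinom, ih, gaussBinom_eq_zero p (by omega)]; ring

theorem gaussBinom_mul_pochSelf (p : ℂ) (i l : ℕ) :
    gaussBinom p (i + l) i * (pochSelf p i * pochSelf p l) = pochSelf p (i + l) := by
  induction i generalizing l with
  | zero => simp [gaussBinom_zero_right, pochSelf]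
  | succ i ihi =>
    induction l with
    | zero => simp [gaussBinom_self, pochSelf]
    | succ l ihl =>
      have h1 := ihi (l + 1)
      have hs : ∀ n, pochSelf p (n + 1) = pochSelf p n * (1 - p * p ^ n) := fun n =>
        Finset.prod_range_succ _ _
      rw [show i + 1 + (l + 1) = (i + 1 + l) + 1 by ring, gaussBinom, hs (i + 1 + l)]
      rw [show i + (l + 1) = i + 1 + l by ring] at h1
      rw [hs l] at h1 ⊢
      rw [hs i] at ihl ⊢
      -- The Pascal rule closes through `1 - p^(i+l+2) = p^(i+1) (1 - p^(l+1)) + (1 - p^(i+1))`.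
      linear_combination (p ^ (i + 1) * (1 - p * p ^ l)) * ihl + (1 - p * p ^ i) * h1

/-- Rothe's `q`-binomial theorem, in base `s ^ 2`. -/
theorem prod_one_add_mul_pow (s u : ℂ) (n : ℕ) :
    ∏ j ∈ Finset.range n, (1 + u * s ^ (2 * j + 1)) =
      ∑ i ∈ Finset.range (n + 1), gaussBinom (s ^ 2) n i * s ^ (i * i) * u ^ i := by
  induction n generalizing u with
  | zero => simp [gaussBinom_zero_right]
  | succ n ih =>
    have h1 : ∏ j ∈ Finset.range n, (1 + u * s ^ (2 * (j + 1) + 1)) =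
        ∏ j ∈ Finset.range n, (1 + u * s ^ 2 * s ^ (2 * j + 1)) :=
      Finset.prod_congr rfl fun j _ => by ring
    have h2 : ∑ i ∈ Finset.range (n + 1), gaussBinom (s ^ 2) n i * s ^ (i * i) * (u * s ^ 2) ^ i =
        ∑ i ∈ Finset.range (n + 1),
          gaussBinom (s ^ 2) n (i + 1) * s ^ ((i + 1) * (i + 1)) * (u * s ^ 2) ^ (i + 1) + 1 := by
      rw [Finset.sum_range_succ', Finset.sum_range_succ _ n, gaussBinom_eq_zero _ (lt_add_one n),
        gaussBinom_zero_right]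
      simp
    -- Peeling off the factor `j = 0` replaces `u` by `u s²` in the rest. Multiplying by `1 + u s`
    -- is then exactly the Pascal recursion.
    rw [Finset.prod_range_succ', h1, ih, Finset.sum_range_succ' _ (n + 1), mul_add, mul_one]
    nth_rw 1 [h2]
    rw [gaussBinom_zero_right, add_right_comm]
    congr 1
    · rw [Finset.sum_mul, ← Finset.sum_add_distrib]
      refine Finset.sum_congr rfl fun i _ => ?_
      rw [gaussBinom]
      ring
    · simp

/-- A finite form of the triple product: Rothe's theorem with `2n` factors at `u = v s^(-2n)`,
recentred at the middle index. -/
theorem prod_triple_eq_sum {s v : ℂ} (hs : s ≠ 0) (hv : v ≠ 0) (n : ℕ) :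
    (∏ j ∈ Finset.range n, (1 + v * s ^ (2 * j + 1))) *
        ∏ j ∈ Finset.range n, (1 + v⁻¹ * s ^ (2 * j + 1)) =
      ∑ i ∈ Finset.range (2 * n + 1), gaussBinom (s ^ 2) (2 * n) i *
        s ^ (((i : ℤ) - n) * ((i : ℤ) - n)) * v ^ ((i : ℤ) - n) := by
  have h1 : ∏ j ∈ Finset.range (2 * n), (1 + v * s ^ (-(2 * n : ℤ)) * s ^ (2 * j + 1)) =
      v ^ n * s ^ (-(n * n : ℤ)) * ((∏ j ∈ Finset.range n, (1 + v * s ^ (2 * j + 1))) *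
        ∏ j ∈ Finset.range n, (1 + v⁻¹ * s ^ (2 * j + 1))) := by
    rw [two_mul n, Finset.prod_range_add, ← Finset.prod_range_reflect (n := n)]
    -- The first `n` factors, read backwards, carry the negative powers `s^(-(2j+1))`. Extracting
    -- the dominant monomial leaves the factors in `v⁻¹`; the exponents extracted add up to `n²`.
    have h2 : ∀ j ∈ Finset.range n, (1 + v * s ^ (-(2 * n : ℤ)) * s ^ (2 * (n - 1 - j) + 1)) =
        v * s ^ (-(2 * j + 1 : ℤ)) * (1 + v⁻¹ * s ^ (2 * j + 1)) := fun j hj => by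
      have hj := Finset.mem_range.1 hj
      obtain ⟨m, rfl⟩ : ∃ m, n = j + 1 + m := ⟨n - (j + 1), by omega⟩
      rw [show j + 1 + m - 1 - j = m by omega, ← zpow_natCast s, ← zpow_natCast s, mul_assoc,
        ← zpow_add₀ hs, mul_add, mul_one, mul_mul_mul_comm, mul_inv_cancel₀ hv, ← zpow_add₀ hs]
      push_cast
      rw [show (-(2 * (j + 1 + m)) + (2 * m + 1) : ℤ) = -(2 * j + 1) by ring, add_comm]
      simp
    have h3 : ∀ j ∈ Finset.range n, (1 + v * s ^ (-(2 * n : ℤ)) * s ^ (2 * (n + j) + 1)) =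
        1 + v * s ^ (2 * j + 1) := fun j _ => by
      rw [← zpow_natCast s, ← zpow_natCast s, mul_assoc, ← zpow_add₀ hs]
      congr 3
      push_cast
      ring
    have h4 : ∏ j ∈ Finset.range n, (v * s ^ (-(2 * j + 1 : ℤ))) = v ^ n * s ^ (-(n * n : ℤ)) := by
      clear h2 h3
      induction n with
      | zero => simp
      | succ n ih =>
        rw [Finset.prod_range_succ, ih, mul_mul_mul_comm, ← zpow_add₀ hs, ← pow_succ]
        congr 2
        push_cast
        ring
    rw [Finset.prod_congr rfl h2, Finset.prod_congr rfl h3, Finset.prod_mul_distrib, h4]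
    ring
  rw [prod_one_add_mul_pow] at h1
  have h5 : v ^ n * s ^ (-(n * n : ℤ)) ≠ 0 := mul_ne_zero (pow_ne_zero _ hv) (zpow_ne_zero _ hs)
  apply mul_left_cancel₀ h5
  rw [← h1, Finset.mul_sum]
  refine Finset.sum_congr rfl fun i _ => ?_
  have e1 : s ^ (i * i) * (s ^ (-(2 * n : ℤ))) ^ i =
      s ^ (-(n * n : ℤ)) * s ^ (((i : ℤ) - n) * ((i : ℤ) - n)) := by
    rw [← zpow_natCast s, ← zpow_natCast (s ^ (-(2 * n : ℤ))), ← zpow_mul, ← zpow_add₀ hs,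
      ← zpow_add₀ hs]
    congr 1
    push_cast
    ring
  have e2 : v ^ i = v ^ n * v ^ ((i : ℤ) - n) := by
    rw [← zpow_natCast v, ← zpow_natCast v, ← zpow_add₀ hv]
    congr 1
    ring
  rw [mul_pow, e2]
  linear_combination (gaussBinom (s ^ 2) (2 * n) i * v ^ n * v ^ ((i : ℤ) - n)) * e1

theorem tendsto_pochSelf {p : ℂ} (hp : ‖p‖ < 1) :
    Tendsto (pochSelf p) atTop (𝓝 (pochInf p p)) :=
  (multipliable_pochInf p hp).hasProd.tendsto_prod_nat

theorem pochSelf_ne_zero {p : ℂ} (hp : ‖p‖ < 1) (n : ℕ) : pochSelf p n ≠ 0 := by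
  refine Finset.prod_ne_zero_iff.2 fun j _ h => ?_
  have h2 : ‖p‖ ^ (j + 1) = 1 := by
    rw [← norm_pow, pow_succ', ← sub_eq_zero.1 h, norm_one]
  exact (pow_lt_one₀ (norm_nonneg p) hp (Nat.succ_ne_zero j)).ne h2

/-- The sequences `(p;p)_n` and their inverses converge, hence are bounded. The uniform bound
supplies the majorant for dominated convergence in the triple product. -/
theorem exists_norm_gaussBinom_le {p : ℂ} (hp : ‖p‖ < 1) :
    ∃ C : ℝ, ∀ n i, ‖gaussBinom p n i‖ ≤ C := by
  obtain ⟨B, hB⟩ := (tendsto_pochSelf hp).norm.bddAbove_range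
  obtain ⟨D, hD⟩ := ((tendsto_pochSelf hp).inv₀ (pochInf_self_ne_zero hp)).norm.bddAbove_range
  have hB' : ∀ n, ‖pochSelf p n‖ ≤ B := fun n => hB ⟨n, rfl⟩
  have hD' : ∀ n, ‖(pochSelf p n)⁻¹‖ ≤ D := fun n => hD ⟨n, rfl⟩
  have hB0 : 0 ≤ B := (norm_nonneg _).trans (hB' 0)
  have hD0 : 0 ≤ D := (norm_nonneg _).trans (hD' 0)
  refine ⟨B * (D * D), fun n i => ?_⟩
  rcases lt_or_ge n i with h | h
  · rw [gaussBinom_eq_zero p h, norm_zero]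
    positivity
  · obtain ⟨l, rfl⟩ := Nat.exists_eq_add_of_le h
    have := gaussBinom_mul_pochSelf p i l
    rw [← eq_mul_inv_iff_mul_eq₀ (mul_ne_zero (pochSelf_ne_zero hp _) (pochSelf_ne_zero hp _)),
      mul_inv] at this
    rw [this, norm_mul, norm_mul]
    gcongr <;> first | exact hB' _ | exact hD' _

theorem tendsto_gaussBinom {p : ℂ} (hp : ‖p‖ < 1) (k : ℤ) :
    Tendsto (fun n : ℕ => gaussBinom p (2 * n) (n + k).toNat) atTop (𝓝 (pochInf p p)⁻¹) := by
  have h0 := pochInf_self_ne_zero hp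
  have hsh : ∀ k : ℤ, Tendsto (fun n : ℕ => (n + k).toNat) atTop atTop := fun k =>
    tendsto_atTop.2 fun b => (eventually_ge_atTop (b + k.natAbs)).mono fun n hn => by omega
  have h2 : Tendsto (fun n : ℕ => 2 * n) atTop atTop :=
    tendsto_atTop.2 fun b => (eventually_ge_atTop b).mono fun n hn => by omega
  have := (((tendsto_pochSelf hp).comp h2).mul
    ((((tendsto_pochSelf hp).comp (hsh k)).mul ((tendsto_pochSelf hp).comp (hsh (-k)))).inv₀
      (mul_ne_zero h0 h0)))
  rw [mul_inv, mul_inv_cancel_left₀ h0] at this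
  refine this.congr' ((eventually_ge_atTop k.natAbs).mono fun n hn => ?_)
  have h3 := gaussBinom_mul_pochSelf p (n + k).toNat (n + -k).toNat
  rw [show (n + k).toNat + (n + -k).toNat = 2 * n by omega] at h3
  simp only [Function.comp]
  rw [← h3, mul_inv_cancel_right₀ (mul_ne_zero (pochSelf_ne_zero hp _) (pochSelf_ne_zero hp _))]

/-- The term is `(σ^n y)^n` with `y = x` or `y = x⁻¹`, and eventually `σ^n y < 1/2`. -/
theorem summable_thetaSeries_real {σ x : ℝ} (hσ0 : 0 < σ) (hσ : σ < 1) (hx : 0 < x) :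
    Summable fun k : ℤ => σ ^ (k * k) * x ^ k := by
  have key : ∀ y : ℝ, 0 < y → Summable fun n : ℕ => σ ^ (n * n) * y ^ n := fun y hy => by
    have h1 : Tendsto (fun n : ℕ => σ ^ n * y) atTop (𝓝 0) := by
      simpa using (tendsto_pow_atTop_nhds_zero_of_lt_one hσ0.le hσ).mul_const y
    refine (summable_geometric_two).of_norm_bounded_eventually_nat ?_
    filter_upwards [h1.eventually_lt_const (show (0 : ℝ) < 1 / 2 by norm_num)] with n hn
    rw [Real.norm_of_nonneg (by positivity), pow_mul, ← mul_pow]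
    exact pow_le_pow_left₀ (by positivity) hn.le n
  refine Summable.of_nat_of_neg ?_ ?_
  · refine (key x hx).congr fun n => ?_
    rw [← zpow_natCast σ, zpow_natCast x]
    push_cast
    rfl
  · refine (key x⁻¹ (by positivity)).congr fun n => ?_
    rw [← zpow_natCast σ, zpow_neg, zpow_natCast x, inv_pow]
    push_cast
    rw [neg_mul_neg]

theorem summable_norm_thetaSeries {s v : ℂ} (hs0 : s ≠ 0) (hs : ‖s‖ < 1) (hv : v ≠ 0) :
    Summable fun k : ℤ => ‖s ^ (k * k) * v ^ k‖ := by
  simp only [norm_mul, norm_zpow]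
  exact summable_thetaSeries_real (norm_pos_iff.2 hs0) hs (norm_pos_iff.2 hv)

/-- The Jacobi triple product identity, with nome `s ^ 2`. -/
theorem jacobi_triple_product {s v : ℂ} (hs0 : s ≠ 0) (hs : ‖s‖ < 1) (hv : v ≠ 0) :
    pochInf (s ^ 2) (s ^ 2) * theta (-(v * s)) (s ^ 2) = ∑' k : ℤ, s ^ (k * k) * v ^ k := by
  have hp : ‖s ^ 2‖ < 1 := by
    rw [norm_pow]
    exact pow_lt_one₀ (norm_nonneg s) hs two_ne_zero
  have hprod : ∀ w : ℂ, Tendsto (fun n => ∏ j ∈ Finset.range n, (1 + w * s ^ (2 * j + 1))) atTop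
      (𝓝 (pochInf (-(w * s)) (s ^ 2))) := fun w => by
    refine (multipliable_pochInf (-(w * s)) hp).hasProd.tendsto_prod_nat.congr fun n => ?_
    refine Finset.prod_congr rfl fun j _ => ?_
    ring
  -- The finite sum is extended by zero to all of `ℤ`. Only the lower cutoff is explicit, since
  -- `toNat` would otherwise send all negative indices to `0`; above, the Gaussian binomial vanishes
  -- by itself.
  let f : ℕ → ℤ → ℂ := fun n k =>
    if -(n : ℤ) ≤ k then gaussBinom (s ^ 2) (2 * n) (n + k).toNat * (s ^ (k * k) * v ^ k) else 0
  have hf : ∀ n, (∏ j ∈ Finset.range n, (1 + v * s ^ (2 * j + 1))) *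
      ∏ j ∈ Finset.range n, (1 + v⁻¹ * s ^ (2 * j + 1)) = ∑' k, f n k := fun n => by
    have hinj : Function.Injective fun i : ℕ => (i : ℤ) - n := fun i j h => by
      simpa using h
    rw [prod_triple_eq_sum hs0 hv, ← hinj.tsum_eq, tsum_eq_sum (s := Finset.range (2 * n + 1))]
    · refine Finset.sum_congr rfl fun i _ => ?_
      simp only [f]
      rw [if_pos (by omega), mul_assoc]
      congr 2
      omega
    · intro i hi
      simp only [f]
      rw [gaussBinom_eq_zero _ (by simp at hi; omega)]
      simp
    · intro k hk
      have : -(n : ℤ) ≤ k := by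
        by_contra h
        exact hk (if_neg h)
      exact ⟨(n + k).toNat, by simp only; omega⟩
  obtain ⟨C, hC⟩ := exists_norm_gaussBinom_le hp
  have hlim : Tendsto (fun n => ∑' k, f n k) atTop
      (𝓝 (∑' k : ℤ, (pochInf (s ^ 2) (s ^ 2))⁻¹ * (s ^ (k * k) * v ^ k))) := by
    refine tendsto_tsum_of_dominated_convergence
      ((summable_norm_thetaSeries hs0 hs hv).mul_left C) (fun k => ?_)
      (Eventually.of_forall fun n k => ?_)
    · refine ((tendsto_gaussBinom hp k).mul_const _).congr'
        ((eventually_ge_atTop k.natAbs).mono fun n hn => ?_)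
      simp only [f]
      rw [if_pos (by omega)]
    · simp only [f]
      split_ifs
      · rw [norm_mul]
        gcongr
        exact hC _ _
      · rw [norm_zero]
        have := (norm_nonneg _).trans (hC 0 0)
        positivity
  have huniq := tendsto_nhds_unique (((hprod v).mul (hprod v⁻¹)).congr hf) hlim
  rw [tsum_mul_left, eq_inv_mul_iff_mul_eq₀ (pochInf_self_ne_zero hp)] at huniq
  rw [← huniq, theta_eq_pochInf _ hp]
  congr 3
  field_simp

/-! ### Parity splitting and the addition formula -/

/-- The theta series `∑ s^(2 i^2) x^(2 i)`. -/
noncomputable def evenSeries (s x : ℂ) : ℂ := ∑' i : ℤ, s ^ (2 * (i * i)) * x ^ (2 * i)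

/-- The theta series `∑ s^(2 i^2 + 2 i) x^(2 i + 1)`. -/
noncomputable def oddSeries (s x : ℂ) : ℂ :=
  ∑' i : ℤ, s ^ (2 * (i * i) + 2 * i) * x ^ (2 * i + 1)

/-- The bijection `ℤ² ⊔ ℤ² → ℤ²` that sorts pairs of integers by the parity of their sum. -/
noncomputable def parityEquiv : (ℤ × ℤ) ⊕ (ℤ × ℤ) ≃ ℤ × ℤ :=
  Equiv.ofBijective
    (Sum.elim (fun z => (z.1 + z.2, z.1 - z.2)) fun z => (z.1 + z.2 + 1, z.1 - z.2)) (by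
      constructor
      · rintro (⟨i, j⟩ | ⟨i, j⟩) (⟨k, l⟩ | ⟨k, l⟩) h <;>
          simp only [Sum.elim_inl, Sum.elim_inr, Prod.mk.injEq] at h <;>
          first
          | (exfalso; omega)
          | (congr 2 <;> omega)
      · rintro ⟨m, n⟩
        rcases Int.even_or_odd' (m + n) with ⟨i, hi | hi⟩
        · exact ⟨Sum.inl (i, m - i), by simp only [Sum.elim_inl, Prod.mk.injEq]; omega⟩
        · exact ⟨Sum.inr (i, m - 1 - i), by simp only [Sum.elim_inr, Prod.mk.injEq]; omega⟩)

theorem parityEquiv_inl (z : ℤ × ℤ) : parityEquiv (Sum.inl z) = (z.1 + z.2, z.1 - z.2) := rfl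

theorem parityEquiv_inr (z : ℤ × ℤ) : parityEquiv (Sum.inr z) = (z.1 + z.2 + 1, z.1 - z.2) := rfl

theorem summable_norm_evenSeries {s x : ℂ} (hs0 : s ≠ 0) (hs : ‖s‖ < 1) (hx : x ≠ 0) :
    Summable fun i : ℤ => ‖s ^ (2 * (i * i)) * x ^ (2 * i)‖ := by
  have hs2 : ‖s ^ 2‖ < 1 := by
    rw [norm_pow]
    exact pow_lt_one₀ (norm_nonneg s) hs two_ne_zero
  refine (summable_norm_thetaSeries (pow_ne_zero 2 hs0) hs2 (pow_ne_zero 2 hx)).congr fun i => ?_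
  rw [zpow_mul s, zpow_mul x]
  norm_cast

theorem summable_norm_oddSeries {s x : ℂ} (hs0 : s ≠ 0) (hs : ‖s‖ < 1) (hx : x ≠ 0) :
    Summable fun i : ℤ => ‖s ^ (2 * (i * i) + 2 * i) * x ^ (2 * i + 1)‖ := by
  refine ((summable_norm_evenSeries hs0 hs (mul_ne_zero hs0 hx)).mul_right ‖x‖).congr fun i => ?_
  rw [← norm_mul, zpow_add₀ hs0, zpow_add₀ hx, mul_zpow, zpow_one]
  congr 1
  ring

/-- The product has general term `s^(m²+n²) x^(m+n) y^(m-n)`. Setting `m + n = 2i` or `2i + 1` makes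
`m² + n²` a sum of a function of `i` and one of `j`, so each parity class factors. -/
theorem tsum_mul_tsum_parity {s x y : ℂ} (hs0 : s ≠ 0) (hs : ‖s‖ < 1) (hx : x ≠ 0)
    (hy : y ≠ 0) :
    (∑' k : ℤ, s ^ (k * k) * (x * y) ^ k) * (∑' k : ℤ, s ^ (k * k) * (x / y) ^ k) =
      evenSeries s x * evenSeries s y + s * (oddSeries s x * oddSeries s y) := by
  have h1 := summable_norm_thetaSeries hs0 hs (mul_ne_zero hx hy)
  have h2 := summable_norm_thetaSeries hs0 hs (div_ne_zero hx hy)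
  rw [tsum_mul_tsum_of_summable_norm h1 h2, evenSeries, evenSeries, oddSeries, oddSeries,
    tsum_mul_tsum_of_summable_norm (summable_norm_evenSeries hs0 hs hx)
      (summable_norm_evenSeries hs0 hs hy),
    tsum_mul_tsum_of_summable_norm (summable_norm_oddSeries hs0 hs hx)
      (summable_norm_oddSeries hs0 hs hy), ← parityEquiv.tsum_eq, ← tsum_mul_left]
  have hxy : ∀ m n : ℤ, (x * y) ^ m * (x / y) ^ n = x ^ (m + n) * y ^ (m - n) := fun m n => by
    rw [mul_zpow, div_zpow, zpow_add₀ hx, zpow_sub₀ hy]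
    ring
  refine (HasSum.sum ?_ ?_).tsum_eq
  · convert! (summable_mul_of_summable_norm (summable_norm_evenSeries hs0 hs hx)
      (summable_norm_evenSeries hs0 hs hy)).hasSum using 1
    funext z
    simp only [Function.comp, parityEquiv_inl]
    rw [mul_mul_mul_comm, hxy, ← zpow_add₀ hs0, mul_mul_mul_comm, ← zpow_add₀ hs0]
    congr 2 <;> ring_nf
  · convert! ((summable_mul_of_summable_norm (summable_norm_oddSeries hs0 hs hx)
      (summable_norm_oddSeries hs0 hs hy)).mul_left s).hasSum using 1
    funext z
    simp only [Function.comp, parityEquiv_inr]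
    rw [mul_mul_mul_comm, hxy, ← zpow_add₀ hs0, mul_mul_mul_comm (s ^ _), ← zpow_add₀ hs0,
      ← mul_assoc s, ← zpow_one_add₀ hs0]
    congr 2 <;> ring_nf

/-- Together with `oddSeries_neg_div`, this says that division of the argument by `s` exchanges the
even and odd series. That exchange turns the sum in `tsum_mul_tsum_parity` into a determinant. -/
theorem evenSeries_div {s x : ℂ} (hs0 : s ≠ 0) (hx : x ≠ 0) :
    evenSeries s (x / s) = x * oddSeries s x := by
  rw [evenSeries, oddSeries, ← tsum_mul_left, ← (Equiv.addRight (1 : ℤ)).tsum_eq]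
  refine tsum_congr fun i => ?_
  simp only [Equiv.coe_addRight]
  rw [div_zpow, mul_div_left_comm, ← zpow_sub₀ hs0, mul_left_comm x, ← zpow_one_add₀ hx, mul_comm]
  congr 2 <;> ring_nf

theorem oddSeries_neg_div {s x : ℂ} (hs0 : s ≠ 0) (hx : x ≠ 0) :
    s * oddSeries s (-x / s) = -(x * evenSeries s x) := by
  rw [evenSeries, oddSeries, ← tsum_mul_left, ← tsum_mul_left, ← tsum_neg]
  refine tsum_congr fun i => ?_
  have h : (-x) ^ (2 * i + 1) = -x ^ (2 * i + 1) := (odd_two_mul_add_one i).neg_zpow x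
  rw [div_zpow, h, neg_div, mul_neg, mul_neg, mul_div_left_comm, ← zpow_sub₀ hs0,
    mul_left_comm x, ← zpow_one_add₀ hx, mul_left_comm s, ← zpow_one_add₀ hs0, mul_comm]
  congr 3 <;> ring_nf

theorem evenSeries_neg (s x : ℂ) : evenSeries s (-x) = evenSeries s x := by
  refine tsum_congr fun i => ?_
  rw [zpow_mul (-x), zpow_mul x]
  norm_num

theorem theta_mul_theta_div {s x y : ℂ} (hs0 : s ≠ 0) (hs : ‖s‖ < 1) (hx : x ≠ 0)
    (hy : y ≠ 0) :
    pochInf (s ^ 2) (s ^ 2) ^ 2 * (theta (x * y) (s ^ 2) * theta (x / y) (s ^ 2)) =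
      x * (oddSeries s x * evenSeries s y - evenSeries s x * oddSeries s y) := by
  have hxs : -x / s ≠ 0 := div_ne_zero (neg_ne_zero.2 hx) hs0
  -- The first argument is `-x/s` because the triple product evaluates theta at `-(v s)`.
  have h := tsum_mul_tsum_parity hs0 hs hxs hy
  rw [← jacobi_triple_product hs0 hs (mul_ne_zero hxs hy),
    ← jacobi_triple_product hs0 hs (div_ne_zero hxs hy),
    show -(-x / s * y * s) = x * y by field_simp, show -(-x / s / y * s) = x / y by field_simp,
    ← mul_assoc s, oddSeries_neg_div hs0 hx, neg_div, evenSeries_neg,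
    evenSeries_div hs0 hx] at h
  linear_combination h

/-- By `theta_mul_theta_div`, every pair of theta functions is a monomial times the determinant with
columns `(oddSeries, evenSeries)` at its two arguments. The identity is the three-term Plücker
relation for four vectors in the plane. -/
theorem theta_addition_aux {s x y u v : ℂ} (hs0 : s ≠ 0) (hs : ‖s‖ < 1) (hx : x ≠ 0) (hy : y ≠ 0)
    (hu : u ≠ 0) (hv : v ≠ 0) :
    theta (x * y) (s ^ 2) * theta (x / y) (s ^ 2) * (theta (u * v) (s ^ 2) * theta (u / v) (s ^ 2))
      - theta (x * v) (s ^ 2) * theta (x / v) (s ^ 2) *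
        (theta (u * y) (s ^ 2) * theta (u / y) (s ^ 2)) =
      u / y * (theta (y * v) (s ^ 2) * theta (y / v) (s ^ 2) *
        (theta (x * u) (s ^ 2) * theta (x / u) (s ^ 2))) := by
  have hp : ‖s ^ 2‖ < 1 := by
    rw [norm_pow]
    exact pow_lt_one₀ (norm_nonneg s) hs two_ne_zero
  have hc : pochInf (s ^ 2) (s ^ 2) ^ 2 * pochInf (s ^ 2) (s ^ 2) ^ 2 ≠ 0 := by
    have := pochInf_self_ne_zero hp
    positivity
  apply mul_left_cancel₀ hc
  have h1 := theta_mul_theta_div hs0 hs hx hy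
  have h2 := theta_mul_theta_div hs0 hs hu hv
  have h3 := theta_mul_theta_div hs0 hs hx hv
  have h4 := theta_mul_theta_div hs0 hs hu hy
  have h5 := theta_mul_theta_div hs0 hs hy hv
  have h6 := theta_mul_theta_div hs0 hs hx hu
  generalize theta (x * y) (s ^ 2) * theta (x / y) (s ^ 2) = t1 at *
  generalize theta (u * v) (s ^ 2) * theta (u / v) (s ^ 2) = t2 at *
  generalize theta (x * v) (s ^ 2) * theta (x / v) (s ^ 2) = t3 at *
  generalize theta (u * y) (s ^ 2) * theta (u / y) (s ^ 2) = t4 at *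
  generalize theta (y * v) (s ^ 2) * theta (y / v) (s ^ 2) = t5 at *
  generalize theta (x * u) (s ^ 2) * theta (x / u) (s ^ 2) = t6 at *
  generalize pochInf (s ^ 2) (s ^ 2) ^ 2 = P at *
  calc P * P * (t1 * t2 - t3 * t4) = (P * t1) * (P * t2) - (P * t3) * (P * t4) := by ring
    _ = u / y * ((P * t5) * (P * t6)) := by
      rw [h1, h2, h3, h4, h5, h6]
      field_simp
      ring
    _ = _ := by ring

/-- The addition formula (Weierstrass' three-term relation) for the theta function. -/
theorem theta_addition {p a e f t : ℂ} (hp0 : p ≠ 0) (hp : ‖p‖ < 1) (ha : a ≠ 0) (he : e ≠ 0)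
    (hf : f ≠ 0) (ht : t ≠ 0) :
    theta (e * t) p * theta (a * t / e) p * (theta (a * f) p * theta (1 / f) p)
      - theta (a * f * t) p * theta (t / f) p * (theta e p * theta (a / e) p) =
      a / e * (theta (e * f) p * theta (e / (a * f)) p * (theta (a * t) p * theta t p)) := by
  obtain ⟨s, rfl⟩ := IsAlgClosed.exists_pow_nat_eq p two_pos
  obtain ⟨b, rfl⟩ := IsAlgClosed.exists_pow_nat_eq a two_pos
  have hs0 : s ≠ 0 := (pow_ne_zero_iff two_ne_zero).1 hp0
  have hb : b ≠ 0 := (pow_ne_zero_iff two_ne_zero).1 ha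
  have hs : ‖s‖ < 1 := by
    rw [norm_pow] at hp
    exact (pow_lt_one_iff_of_nonneg (norm_nonneg s) two_ne_zero).1 hp
  -- With `b² = a`, the symmetric variables are `x = b t`, `y = e / b`, `u = b`, `v = b f`; the
  -- square root drops out of all products and quotients.
  have h := theta_addition_aux hs0 hs (mul_ne_zero hb ht) (div_ne_zero he hb) hb
    (mul_ne_zero hb hf)
  convert! h using 1
  · congr 1
    · congr 2 <;> congr 1 <;> field_simp
    · congr 2 <;> congr 1 <;> field_simp
  · congr 1
    · field_simp
    · congr 2 <;> congr 1 <;> field_simp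

/-! ### The Frenkel–Turaev summation -/

theorem ellFac_zero (x q p : ℂ) : ellFac x q p 0 = 1 := Finset.prod_range_zero _

theorem ellFac_succ {x y q p : ℂ} {j : ℕ} (h : x * q ^ j = y) :
    ellFac x q p (j + 1) = ellFac x q p j * theta y p := by
  rw [ellFac, Finset.prod_range_succ, h, ellFac]

theorem ellFac_succ' {x y q p : ℂ} (j : ℕ) (h : x * q = y) :
    ellFac x q p (j + 1) = theta x p * ellFac y q p j := by
  rw [ellFac, Finset.prod_range_succ', pow_zero, mul_one, mul_comm, ellFac]
  congr 1
  refine Finset.prod_congr rfl fun i _ => ?_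
  rw [← h, pow_succ']
  ring_nf

theorem ellFac_ne_zero {x q p : ℂ} {n : ℕ} (h : ∀ i < n, theta (x * q ^ i) p ≠ 0) :
    ellFac x q p n ≠ 0 :=
  Finset.prod_ne_zero_iff.2 fun i hi => h i (Finset.mem_range.1 hi)

/-- No theta function of `x q^i`, `i ∈ ℤ`, vanishes. -/
def ThetaGeneric (q p x : ℂ) : Prop := ∀ i : ℤ, theta (x * q ^ i) p ≠ 0

theorem ThetaGeneric.of_eq {q p x y : ℂ} (hq : q ≠ 0) (h : ThetaGeneric q p x) (i : ℤ)
    (hy : x * q ^ i = y) : ThetaGeneric q p y := fun j => by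
  rw [← hy, mul_assoc, ← zpow_add₀ hq]
  exact h _

theorem ThetaGeneric.theta_ne_zero {q p x y : ℂ} (h : ThetaGeneric q p x) (i : ℤ)
    (hy : x * q ^ i = y) : theta y p ≠ 0 := hy ▸ h i

theorem ThetaGeneric.ellFac_ne_zero {q p x y : ℂ} (hq : q ≠ 0) (h : ThetaGeneric q p x) (i : ℤ)
    (hy : x * q ^ i = y) (n : ℕ) : ellFac y q p n ≠ 0 :=
  EllHyp.ellFac_ne_zero fun j _ => by
    have := (h.of_eq hq i hy) j
    rwa [zpow_natCast] at this

/-- The general term of the terminating very-well-poised series in the Frenkel–Turaev sum. -/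
noncomputable def ftTerm (N : ℕ) (a b c d e q p : ℂ) (k : ℕ) : ℂ :=
  theta (a * q ^ (2 * k)) p / theta a p *
    (ellFac a q p k * ellFac b q p k * ellFac c q p k * ellFac d q p k * ellFac e q p k *
        ellFac (q ^ N)⁻¹ q p k * q ^ k /
      (ellFac q q p k * ellFac (a * q / b) q p k * ellFac (a * q / c) q p k *
        ellFac (a * q / d) q p k * ellFac (a * q / e) q p k * ellFac (a * q ^ (N + 1)) q p k))

/-- The closed form of the Frenkel–Turaev sum. -/
noncomputable def ftSum (N : ℕ) (a b c d q p : ℂ) : ℂ :=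
  ellFac (a * q) q p N * ellFac (a * q / (b * c)) q p N * ellFac (a * q / (b * d)) q p N *
      ellFac (a * q / (c * d)) q p N /
    (ellFac (a * q / b) q p N * ellFac (a * q / c) q p N * ellFac (a * q / d) q p N *
      ellFac (a * q / (b * c * d)) q p N)

/-- The coefficient in the contiguous relations for `ftTerm` and `ftSum`. -/
noncomputable def ftCoeff (N : ℕ) (a b c d e q p : ℂ) : ℂ :=
  q * (a / e) * theta (a * q) p * theta (a * q ^ 2) p * theta b p * theta c p * theta d p *
      theta (e * q ^ (N + 1)) p * theta (e / (a * q ^ (N + 1))) p /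
    (theta (a * q / b) p * theta (a * q / c) p * theta (a * q / d) p * theta (a * q / e) p *
      theta (a * q ^ (N + 1)) p * theta (a * q ^ (N + 2)) p * theta (a / e) p)

section
variable {N : ℕ} {a b c d e q p : ℂ}

/-- The balancing condition makes `e` grow by a factor `q` with each step of `N`. The three terms
share a common factor; what is left depends on `j` and `N` only through the addition formula with `f
= q^(N+1)` and `t = q^(j+1)`. The coefficient `ftCoeff` is independent of `j`, so the relation can
be summed. -/
theorem ftTerm_contiguous (hp0 : p ≠ 0) (hp : ‖p‖ < 1) (hq : q ≠ 0) (ha : a ≠ 0) (hb : b ≠ 0)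
    (hc : c ≠ 0) (hd : d ≠ 0) (he : e ≠ 0)
    (hqN : ∀ i ≤ N, theta (q * q ^ i) p ≠ 0) (gA : ThetaGeneric q p a)
    (gB : ThetaGeneric q p (a / b)) (gC : ThetaGeneric q p (a / c)) (gD : ThetaGeneric q p (a / d))
    (gE : ThetaGeneric q p (a / e)) {j : ℕ} (hj : j ≤ N) :
    ftTerm (N + 1) a b c d (e * q) q p (j + 1) = ftTerm N a b c d e q p (j + 1) +
      ftCoeff N a b c d e q p * ftTerm N (a * q ^ 2) (b * q) (c * q) (d * q) (e * q) q p j := by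
  have hadd := theta_addition hp0 hp ha he (pow_ne_zero (N + 1) hq) (pow_ne_zero (j + 1) hq)
  have hfac : ∀ {x y : ℂ}, ThetaGeneric q p x → ∀ i : ℤ, x * q ^ i = y → ∀ n,
    ellFac y q p n ≠ 0 := fun h i hy n => h.ellFac_ne_zero hq i hy n
  have n1 : ellFac q q p j ≠ 0 := ellFac_ne_zero fun i hi => hqN i (by omega)
  have n2 : theta (q ^ (j + 1)) p ≠ 0 := by
    rw [pow_succ']; exact hqN j hj
  have n3 : theta a p ≠ 0 := gA.theta_ne_zero 0 (by simp)
  have n4 : theta (a * q) p ≠ 0 := gA.theta_ne_zero 1 (by simp)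
  have n5 : theta (a * q ^ 2) p ≠ 0 := gA.theta_ne_zero 2 (by norm_cast)
  have n6 : theta (a * q ^ (N + 1)) p ≠ 0 := gA.theta_ne_zero (N + 1 : ℕ) (by norm_cast)
  have n7 : theta (a * q ^ (N + 2)) p ≠ 0 := gA.theta_ne_zero (N + 2 : ℕ) (by norm_cast)
  have n8 : theta (a * q ^ (N + 1) * q ^ (j + 1)) p ≠ 0 :=
    gA.theta_ne_zero ((N + 1) + (j + 1) : ℕ) (by rw [zpow_natCast]; ring)
  have n9 : theta (a * q / b) p ≠ 0 := gB.theta_ne_zero 1 (by rw [zpow_one]; ring)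
  have n10 : theta (a * q / c) p ≠ 0 := gC.theta_ne_zero 1 (by rw [zpow_one]; ring)
  have n11 : theta (a * q / d) p ≠ 0 := gD.theta_ne_zero 1 (by rw [zpow_one]; ring)
  have n12 : theta (a * q / e) p ≠ 0 := gE.theta_ne_zero 1 (by rw [zpow_one]; ring)
  have n13 : theta (a / e) p ≠ 0 := gE.theta_ne_zero 0 (by simp)
  have n14 : theta (a * q ^ (j + 1) / e) p ≠ 0 :=
    gE.theta_ne_zero (j + 1 : ℕ) (by rw [zpow_natCast]; ring)
  have n15 : theta (a * q ^ (j + 1)) p ≠ 0 := gA.theta_ne_zero (j + 1 : ℕ) (by norm_cast)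
  have n16 : ellFac (a * q ^ 2 * q / (b * q)) q p j ≠ 0 :=
    hfac gB 2 (by norm_cast; field_simp) j
  have n17 : ellFac (a * q ^ 2 * q / (c * q)) q p j ≠ 0 :=
    hfac gC 2 (by norm_cast; field_simp) j
  have n18 : ellFac (a * q ^ 2 * q / (d * q)) q p j ≠ 0 :=
    hfac gD 2 (by norm_cast; field_simp) j
  have n19 : ellFac (a * q ^ 2 * q / (e * q)) q p j ≠ 0 :=
    hfac gE 2 (by norm_cast; field_simp) j
  have n20 : ellFac (a * q ^ 2 * q ^ (N + 1)) q p j ≠ 0 :=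
    hfac gA (N + 3 : ℕ) (by rw [zpow_natCast]; ring) j
  have n21 : ellFac (a * q / e) q p j ≠ 0 := hfac gE 1 (by rw [zpow_one]; ring) j
  have n22 : ellFac (a * q ^ (N + 2)) q p j ≠ 0 := hfac gA (N + 2 : ℕ) (by norm_cast) j
  have s1 : ellFac a q p (j + 1) * theta (a * q ^ (j + 1)) p =
      theta a p * (theta (a * q) p * ellFac (a * q ^ 2) q p j) := by
    rw [← ellFac_succ rfl, ellFac_succ' (j + 1) rfl, ellFac_succ' j (show a * q * q = a * q ^ 2 by ring)]
  have s2 := ellFac_succ' (x := b) (q := q) (p := p) j rfl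
  have s3 := ellFac_succ' (x := c) (q := q) (p := p) j rfl
  have s4 := ellFac_succ' (x := d) (q := q) (p := p) j rfl
  have s5 := ellFac_succ' (x := e) (q := q) (p := p) j rfl
  have s6 : ellFac (e * q) q p (j + 1) = ellFac (e * q) q p j * theta (e * q ^ (j + 1)) p :=
    ellFac_succ (by ring)
  have s7 : ellFac (q ^ (N + 1))⁻¹ q p (j + 1) =
      theta (1 / q ^ (N + 1)) p * ellFac (q ^ N)⁻¹ q p j := by
    rw [one_div]
    exact ellFac_succ' j (by rw [pow_succ]; field_simp)
  have s8 : ellFac (q ^ N)⁻¹ q p (j + 1) =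
      ellFac (q ^ N)⁻¹ q p j * theta (q ^ (j + 1) / q ^ (N + 1)) p :=
    ellFac_succ (by rw [pow_succ q j, pow_succ q N]; field_simp)
  have s9 : ellFac q q p (j + 1) = ellFac q q p j * theta (q ^ (j + 1)) p := ellFac_succ (by ring)
  have s10 : ellFac (a * q / b) q p (j + 1) =
      theta (a * q / b) p * ellFac (a * q ^ 2 * q / (b * q)) q p j :=
    ellFac_succ' j (by field_simp)
  have s11 : ellFac (a * q / c) q p (j + 1) =
      theta (a * q / c) p * ellFac (a * q ^ 2 * q / (c * q)) q p j :=
    ellFac_succ' j (by field_simp)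
  have s12 : ellFac (a * q / d) q p (j + 1) =
      theta (a * q / d) p * ellFac (a * q ^ 2 * q / (d * q)) q p j :=
    ellFac_succ' j (by field_simp)
  have s13 : ellFac (a * q / e) q p (j + 1) =
      theta (a * q / e) p * ellFac (a * q ^ 2 * q / (e * q)) q p j :=
    ellFac_succ' j (by field_simp)
  have s14 : ellFac (a * q / (e * q)) q p (j + 1) = theta (a / e) p * ellFac (a * q / e) q p j := by
    rw [mul_div_mul_right _ _ hq]
    exact ellFac_succ' j (by field_simp)
  have s15 : ellFac (a * q / e) q p j * theta (a * q ^ (j + 1) / e) p =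
      theta (a * q / e) p * ellFac (a * q ^ 2 * q / (e * q)) q p j := by
    rw [← s13]
    exact (ellFac_succ (by ring)).symm
  have s16 : ellFac (a * q ^ (N + 1)) q p (j + 1) =
      theta (a * q ^ (N + 1)) p * ellFac (a * q ^ (N + 2)) q p j :=
    ellFac_succ' j (by ring)
  have s17 : ellFac (a * q ^ (N + 1 + 1)) q p (j + 1) =
      theta (a * q ^ (N + 2)) p * ellFac (a * q ^ 2 * q ^ (N + 1)) q p j :=
    ellFac_succ' j (by ring)
  have s18 : ellFac (a * q ^ (N + 2)) q p j * theta (a * q ^ (N + 1) * q ^ (j + 1)) p =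
      theta (a * q ^ (N + 2)) p * ellFac (a * q ^ 2 * q ^ (N + 1)) q p j := by
    rw [← s17]
    exact (ellFac_succ (by ring)).symm
  rw [← eq_div_iff n15] at s1
  rw [← eq_div_iff n14] at s15
  rw [← eq_div_iff n8] at s18
  have hkey : theta (a * q ^ 2 * q ^ (2 * j)) p = theta (a * q ^ (2 * (j + 1))) p := by
    congr 1; ring
  simp only [ftTerm, ftCoeff, s2, s3, s4, s5, s6, s7, s8, s9, s10, s11, s12, s13, s14, s16, s17]
  rw [s1, s15, s18, hkey]
  clear s1 s2 s3 s4 s5 s6 s7 s8 s9 s10 s11 s12 s13 s14 s15 s16 s17 s18 hkey hfac gA gB gC gD gE hqN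
    n21 n22
  generalize theta (a * q ^ (2 * (j + 1))) p = X1 at *
  generalize theta a p = X2 at *
  generalize theta (a * q) p = X3 at *
  generalize theta (a * q ^ 2) p = X4 at *
  generalize theta (a * q ^ (N + 1)) p = X5 at *
  generalize theta (a * q ^ (N + 2)) p = X6 at *
  generalize theta (a * q ^ (N + 1) * q ^ (j + 1)) p = X7 at *
  generalize theta (a * q / b) p = X8 at *
  generalize theta (a * q / c) p = X9 at *
  generalize theta (a * q / d) p = X10 at *
  generalize theta (a * q / e) p = X11 at *
  generalize theta (a / e) p = X12 at *
  generalize theta (a * q ^ (j + 1) / e) p = X13 at *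
  generalize theta (a * q ^ (j + 1)) p = X14 at *
  generalize theta (q ^ (j + 1)) p = X15 at *
  generalize theta (1 / q ^ (N + 1)) p = X16 at *
  generalize theta (q ^ (j + 1) / q ^ (N + 1)) p = X17 at *
  generalize theta (e * q ^ (N + 1)) p = X18 at *
  generalize theta (e / (a * q ^ (N + 1))) p = X19 at *
  generalize theta (e * q ^ (j + 1)) p = X20 at *
  generalize theta b p = X21 at *
  generalize theta c p = X22 at *
  generalize theta d p = X23 at *
  generalize theta e p = X24 at *
  generalize ellFac (a * q ^ 2 * q / (b * q)) q p j = Y1 at *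
  generalize ellFac (a * q ^ 2 * q / (c * q)) q p j = Y2 at *
  generalize ellFac (a * q ^ 2 * q / (d * q)) q p j = Y3 at *
  generalize ellFac (a * q ^ 2 * q / (e * q)) q p j = Y4 at *
  generalize ellFac (a * q ^ 2 * q ^ (N + 1)) q p j = Y5 at *
  generalize ellFac (a * q ^ 2) q p j = Y6 at *
  generalize ellFac (b * q) q p j = Y7 at *
  generalize ellFac (c * q) q p j = Y8 at *
  generalize ellFac (d * q) q p j = Y9 at *
  generalize ellFac (e * q) q p j = Y10 at *
  generalize ellFac (q ^ N)⁻¹ q p j = Y11 at *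
  generalize ellFac q q p j = Y12 at *
  clear hp0 hp hj
  have hK : X20 * X13 * (X5 * X16) = X7 * X17 * (X24 * X12) + a / e * (X18 * X19 * (X14 * X15)) := by
    linear_combination hadd
  -- `K` is the common factor; `hK` is the addition formula in the abbreviated variables.
  obtain ⟨K, hKdef⟩ : ∃ K, K = X1 / X2 * (X2 * X3 * Y6 / X14 * (X21 * Y7) * (X22 * Y8) * (X23 * Y9) * Y10 * Y11 *
    q ^ (j + 1)) / (Y12 * X15 * (X8 * Y1) * (X9 * Y2) * (X10 * Y3) * (X11 * X12 * Y4) *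
      (X5 * X6 * Y5)) := ⟨_, rfl⟩
  trans K * (X20 * X13 * (X5 * X16))
  · rw [hKdef]
    clear hK hadd hKdef
    simp only [mul_div_assoc', div_mul_eq_mul_div, div_div, div_div_eq_mul_div]
    rw [div_eq_div_iff (by simp [*]) (by simp [*])]
    ring
  rw [hK, mul_add]
  congr 1
  · rw [hKdef]
    clear hK hadd hKdef
    simp only [mul_div_assoc', div_mul_eq_mul_div, div_div, div_div_eq_mul_div]
    rw [div_eq_div_iff (by simp [*]) (by simp [*])]
    ring
  · rw [hKdef]
    clear hK hadd hKdef
    simp only [mul_div_assoc', div_mul_eq_mul_div, div_div]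
    rw [div_eq_div_iff (by simp [*]) (by simp [*])]
    ring

/-- After the common shifted factorials are removed, this is again one addition formula, now in the
last theta factors of the closed form, which are functions of `l = a q^(N+1)`. -/
theorem ftSum_contiguous (hp0 : p ≠ 0) (hp : ‖p‖ < 1) (hq : q ≠ 0) (ha : a ≠ 0) (hb : b ≠ 0)
    (hc : c ≠ 0) (hd : d ≠ 0) (he : e = a ^ 2 * q ^ (N + 1) / (b * c * d))
    (gA : ThetaGeneric q p a)
    (gB : ThetaGeneric q p (a / b)) (gC : ThetaGeneric q p (a / c)) (gD : ThetaGeneric q p (a / d))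
    (gE : ThetaGeneric q p (a / (b * c * d))) :
    ftSum (N + 1) a b c d q p = ftSum N a b c d q p +
      ftCoeff N a b c d e q p * ftSum N (a * q ^ 2) (b * q) (c * q) (d * q) q p := by
  have hfac : ∀ {x y : ℂ}, ThetaGeneric q p x → ∀ i : ℤ, x * q ^ i = y → ∀ n,
    ellFac y q p n ≠ 0 := fun h i hy n => h.ellFac_ne_zero hq i hy n
  obtain ⟨l, hl⟩ : ∃ l, l = a * q ^ (N + 1) := ⟨_, rfl⟩
  have hl0 : l ≠ 0 := hl ▸ mul_ne_zero ha (pow_ne_zero _ hq)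
  have hal : a = l / q ^ (N + 1) := by rw [hl]; field_simp
  have hw0 : l / (b * c * d) ≠ 0 := div_ne_zero hl0 (by simp [*])
  have hadd := theta_addition (a := l ^ 2 / (b * c)) (e := l / b) (f := b * c / l) (t := 1 / d)
    hp0 hp (by positivity) (by positivity) (by positivity) (one_div_ne_zero hd)
  rw [show l / b * (1 / d) = l / (b * d) by field_simp,
    show l ^ 2 / (b * c) * (1 / d) / (l / b) = l / (c * d) by field_simp,
    show l ^ 2 / (b * c) * (b * c / l) = l by field_simp,
    show 1 / (b * c / l) = l / (b * c) by field_simp,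
    show l * (1 / d) = l / d by field_simp,
    show 1 / d / (b * c / l) = l / (b * c * d) by field_simp,
    show l ^ 2 / (b * c) / (l / b) = l / c by field_simp,
    show l / b * (b * c / l) = c by field_simp,
    show l / b / l = b⁻¹ by field_simp,
    show l ^ 2 / (b * c) * (1 / d) = l ^ 2 / (b * c * d) by field_simp,
    one_div, theta_inv hb hp, theta_inv hd hp] at hadd
  have e1 : e * q ^ (N + 1) = l ^ 2 / (b * c * d) := by rw [he, hl]; ring
  have e2 : e / (a * q ^ (N + 1)) = a / (b * c * d) := by rw [he]; field_simp
  have e3 : a / e = (l / (b * c * d))⁻¹ := by rw [he, hl]; field_simp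
  have e4 : a * q / e = (l / (b * c * d) / q)⁻¹ := by rw [he, hl]; field_simp
  have i1 : theta (a / e) p = -theta (l / (b * c * d)) p / (l / (b * c * d)) := by
    rw [e3, theta_inv hw0 hp]
  have i2 : theta (a * q / e) p = -theta (l / (b * c * d) / q) p / (l / (b * c * d) / q) := by
    rw [e4, theta_inv (div_ne_zero hw0 hq) hp]
  have n4 : theta (a * q) p ≠ 0 := gA.theta_ne_zero 1 (by simp)
  have n5 : theta (a * q ^ 2) p ≠ 0 := gA.theta_ne_zero 2 (by norm_cast)
  have n6 : theta l p ≠ 0 := gA.theta_ne_zero (N + 1 : ℕ) (by rw [hl]; norm_cast)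
  have n7 : theta (a * q ^ (N + 2)) p ≠ 0 := gA.theta_ne_zero (N + 2 : ℕ) (by norm_cast)
  have n9 : theta (a * q / b) p ≠ 0 := gB.theta_ne_zero 1 (by rw [zpow_one]; ring)
  have n10 : theta (a * q / c) p ≠ 0 := gC.theta_ne_zero 1 (by rw [zpow_one]; ring)
  have n11 : theta (a * q / d) p ≠ 0 := gD.theta_ne_zero 1 (by rw [zpow_one]; ring)
  have n12 : theta (a / (b * c * d)) p ≠ 0 := gE.theta_ne_zero 0 (by simp)
  have n13 : theta (l / (b * c * d)) p ≠ 0 :=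
    gE.theta_ne_zero (N + 1 : ℕ) (by rw [hl, zpow_natCast]; ring)
  have n14 : theta (l / (b * c * d) / q) p ≠ 0 :=
    gE.theta_ne_zero N (by rw [hl, zpow_natCast, pow_succ]; field_simp)
  have n15 : theta (l / b) p ≠ 0 :=
    gB.theta_ne_zero (N + 1 : ℕ) (by rw [hl, zpow_natCast]; ring)
  have n16 : theta (l / c) p ≠ 0 :=
    gC.theta_ne_zero (N + 1 : ℕ) (by rw [hl, zpow_natCast]; ring)
  have n17 : theta (l / d) p ≠ 0 :=
    gD.theta_ne_zero (N + 1 : ℕ) (by rw [hl, zpow_natCast]; ring)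
  have n18 : ellFac (a * q / b) q p N ≠ 0 := hfac gB 1 (by rw [zpow_one]; ring) N
  have n19 : ellFac (a * q / c) q p N ≠ 0 := hfac gC 1 (by rw [zpow_one]; ring) N
  have n20 : ellFac (a * q / d) q p N ≠ 0 := hfac gD 1 (by rw [zpow_one]; ring) N
  have n21 : ellFac (a * q / (b * c * d)) q p N ≠ 0 := hfac gE 1 (by rw [zpow_one]; ring) N
  have s1 : ellFac (a * q) q p (N + 1) = ellFac (a * q) q p N * theta l p :=
    ellFac_succ (by rw [hl]; ring)
  have s2 : ellFac (a * q / (b * c)) q p (N + 1) =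
      ellFac (a * q / (b * c)) q p N * theta (l / (b * c)) p := ellFac_succ (by rw [hl]; ring)
  have s3 : ellFac (a * q / (b * d)) q p (N + 1) =
      ellFac (a * q / (b * d)) q p N * theta (l / (b * d)) p := ellFac_succ (by rw [hl]; ring)
  have s4 : ellFac (a * q / (c * d)) q p (N + 1) =
      ellFac (a * q / (c * d)) q p N * theta (l / (c * d)) p := ellFac_succ (by rw [hl]; ring)
  have s5 : ellFac (a * q / b) q p (N + 1) = ellFac (a * q / b) q p N * theta (l / b) p :=
    ellFac_succ (by rw [hl]; ring)
  have s6 : ellFac (a * q / c) q p (N + 1) = ellFac (a * q / c) q p N * theta (l / c) p :=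
    ellFac_succ (by rw [hl]; ring)
  have s7 : ellFac (a * q / d) q p (N + 1) = ellFac (a * q / d) q p N * theta (l / d) p :=
    ellFac_succ (by rw [hl]; ring)
  have s8 : ellFac (a * q / (b * c * d)) q p (N + 1) =
      ellFac (a * q / (b * c * d)) q p N * theta (l / (b * c * d)) p :=
    ellFac_succ (by rw [hl]; ring)
  have t1 : ellFac (a * q ^ 2 * q) q p N =
      ellFac (a * q) q p N * theta l p * theta (a * q ^ (N + 2)) p /
        (theta (a * q) p * theta (a * q ^ 2) p) := by
    rw [eq_div_iff (mul_ne_zero n4 n5), ← s1, ← ellFac_succ (by ring),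
      ellFac_succ' (N + 1) (show a * q * q = a * q ^ 2 by ring), ellFac_succ' N rfl]
    ring
  have t2 : ∀ x y : ℂ, x ≠ 0 → y ≠ 0 →
      a * q ^ 2 * q / (x * q * (y * q)) = a * q / (x * y) := fun x y hx hy => by field_simp
  have t5 : ∀ x : ℂ, x ≠ 0 → theta (a * q / x) p ≠ 0 → ellFac (a * q ^ 2 * q / (x * q)) q p N =
      ellFac (a * q / x) q p N * theta (l / x) p / theta (a * q / x) p := fun x hx h => by
    rw [eq_div_iff h, mul_comm]
    exact (ellFac_succ' N (by field_simp)).symm.trans (ellFac_succ (by rw [hl]; ring))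
  have t8 : ellFac (a * q ^ 2 * q / (b * q * (c * q) * (d * q))) q p N =
      theta (a / (b * c * d)) p * ellFac (a * q / (b * c * d)) q p N /
        theta (l / (b * c * d) / q) p := by
    rw [eq_div_iff n14, ← ellFac_succ' N (by ring),
      show a * q ^ 2 * q / (b * q * (c * q) * (d * q)) = a / (b * c * d) by field_simp]
    exact (ellFac_succ (by rw [hl, pow_succ]; field_simp)).symm
  simp only [ftSum, ftCoeff, s1, s2, s3, s4, s5, s6, s7, s8]
  rw [t1, t2 b c hb hc, t2 b d hb hd, t2 c d hc hd, t5 b hb n9, t5 c hc n10, t5 d hd n11, t8, e1,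
    e2, i1, i2, e3, ← hl]
  clear s1 s2 s3 s4 s5 s6 s7 s8 t1 t2 t5 t8 hfac gA gB gC gD gE e1 e2 e3 e4 i1 i2 he
  generalize hw : l / (b * c * d) = w at *
  generalize theta (a * q) p = X3 at *
  generalize theta (a * q ^ 2) p = X4 at *
  generalize theta (a * q ^ (N + 2)) p = X6 at *
  generalize theta (a * q / b) p = X8 at *
  generalize theta (a * q / c) p = X9 at *
  generalize theta (a * q / d) p = X10 at *
  generalize theta (a / (b * c * d)) p = X11 at *
  generalize theta w p = X12 at *
  generalize theta (w / q) p = X13 at *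
  generalize theta (l / b) p = X14 at *
  generalize theta (l / c) p = X15 at *
  generalize theta (l / d) p = X16 at *
  generalize theta (l / (b * c)) p = X17 at *
  generalize theta (l / (b * d)) p = X18 at *
  generalize theta (l / (c * d)) p = X19 at *
  generalize theta (l ^ 2 / (b * c * d)) p = X20 at *
  generalize theta b p = X21 at *
  generalize theta c p = X22 at *
  generalize theta d p = X23 at *
  generalize theta l p = X24 at *
  generalize ellFac (a * q / b) q p N = Y1 at *
  generalize ellFac (a * q / c) q p N = Y2 at *
  generalize ellFac (a * q / d) q p N = Y3 at *
  generalize ellFac (a * q / (b * c * d)) q p N = Y4 at *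
  generalize ellFac (a * q / (b * c)) q p N = Y5 at *
  generalize ellFac (a * q / (b * d)) q p N = Y6 at *
  generalize ellFac (a * q / (c * d)) q p N = Y7 at *
  generalize ellFac (a * q) q p N = Y8 at *
  have hK : X24 * X17 * X18 * X19 = X14 * X15 * X16 * X12 + w * (X21 * X22 * X23 * X20) := by
    have : l / c * (X22 * (-X21 / b) * (X20 * (-X23 / d))) = w * (X21 * X22 * X23 * X20) := by
      rw [← hw]
      field_simp
    linear_combination hadd + this
  obtain ⟨K, hKdef⟩ : ∃ K, K = Y8 * Y5 * Y6 * Y7 / (Y1 * Y2 * Y3 * Y4 * X14 * X15 * X16 * X12) :=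
    ⟨_, rfl⟩
  clear hp hp0 hal hl hadd hw
  trans K * (X24 * X17 * X18 * X19)
  · rw [hKdef]
    ring
  rw [hK, mul_add]
  congr 1
  · rw [hKdef, div_mul_eq_mul_div, div_eq_div_iff (by simp [*]) (by simp [*])]
    ring
  · rw [hKdef]
    clear hK hKdef
    simp only [mul_div_assoc', div_mul_eq_mul_div, mul_neg, neg_mul, neg_div, neg_neg, inv_eq_one_div,
      div_div, div_div_eq_mul_div]
    rw [div_eq_div_iff (by simp [*]) (by simp [*])]
    ring

/-- The Frenkel–Turaev sum. -/
theorem sum_ftTerm (hp0 : p ≠ 0) (hp : ‖p‖ < 1) (hq : q ≠ 0) (ha : a ≠ 0) (hb : b ≠ 0)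
    (hc : c ≠ 0) (hd : d ≠ 0) (he : e = a ^ 2 * q ^ (N + 1) / (b * c * d))
    (hqN : ∀ i < N, theta (q * q ^ i) p ≠ 0) (gA : ThetaGeneric q p a)
    (gB : ThetaGeneric q p (a / b)) (gC : ThetaGeneric q p (a / c)) (gD : ThetaGeneric q p (a / d))
    (gE : ThetaGeneric q p (a / (b * c * d))) (gE' : ThetaGeneric q p (a / e)) :
    ∑ k ∈ Finset.range (N + 1), ftTerm N a b c d e q p k = ftSum N a b c d q p := by
  have hterm0 : ∀ N a b c d e, ThetaGeneric q p a → ftTerm N a b c d e q p 0 = 1 :=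
    fun N a b c d e h => by
      have : theta a p ≠ 0 := h.theta_ne_zero 0 (by simp)
      simp [ftTerm, ellFac_zero, this]
  induction N generalizing a b c d e with
  | zero => simp [hterm0 _ _ _ _ _ _ gA, ftSum, ellFac_zero]
  | succ N ih =>
    obtain ⟨e', rfl⟩ : ∃ e', e = e' * q := ⟨e / q, by field_simp⟩
    have he' : e' = a ^ 2 * q ^ (N + 1) / (b * c * d) := by
      apply mul_right_cancel₀ hq
      rw [he]
      ring
    have he0 : e' ≠ 0 := he' ▸ by positivity
    have gE'' : ThetaGeneric q p (a / e') := gE'.of_eq hq 1 (by rw [zpow_one]; field_simp)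
    -- The shorter series stops at index `N`: at `N + 1` the factorial of `q^(-N)` contains `θ(1) =
    -- 0`. Both sums can thus run over the same range.
    have hlast : ftTerm N a b c d e' q p (N + 1) = 0 := by
      rw [ftTerm, ellFac_succ (x := (q ^ N)⁻¹) (y := 1) (by field_simp), theta_one hp]
      simp
    have hi1 := ih ha hb hc hd he' (fun i hi => hqN i (by omega)) gA gB gC gD gE gE''
    -- The shifted parameters are balanced again for the same `N`, their last parameter being `e'
    -- q`.
    have hi2 := ih (a := a * q ^ 2) (b := b * q) (c := c * q) (d := d * q) (e := e' * q)
      (by positivity) (by positivity) (by positivity) (by positivity)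
      (by rw [he']; field_simp) (fun i hi => hqN i (by omega))
      (gA.of_eq hq 2 (by norm_cast)) (gB.of_eq hq 1 (by rw [zpow_one]; field_simp))
      (gC.of_eq hq 1 (by rw [zpow_one]; field_simp)) (gD.of_eq hq 1 (by rw [zpow_one]; field_simp))
      (gE.of_eq hq (-1) (by rw [zpow_neg_one]; field_simp))
      (gE''.of_eq hq 1 (by rw [zpow_one]; field_simp))
    rw [ftSum_contiguous hp0 hp hq ha hb hc hd he' gA gB gC gD gE, ← hi1, ← hi2,
      Finset.sum_range_succ', hterm0 _ _ _ _ _ _ gA,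
      Finset.sum_congr rfl fun j hj => ftTerm_contiguous hp0 hp hq ha hb hc hd he0
        (fun i hi => hqN i (by omega)) gA gB gC gD gE'' (Finset.mem_range_succ_iff.1 hj),
      Finset.sum_add_distrib, Finset.mul_sum, Finset.sum_range_succ _ N, hlast,
      Finset.sum_range_succ' (fun k => ftTerm N a b c d e' q p k), hterm0 _ _ _ _ _ _ gA]
    ring

end

/-! ### The quadratic transformation for generic parameters -/

theorem ellFac_add {x y q p : ℂ} {u : ℕ} (v : ℕ) (h : x * q ^ u = y) :
    ellFac x q p (u + v) = ellFac x q p u * ellFac y q p v := by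
  rw [ellFac, Finset.prod_range_add, ellFac, ellFac, ← h]
  congr 1
  refine Finset.prod_congr rfl fun i _ => ?_
  rw [pow_add, mul_assoc]

theorem ellFac_two_mul (x q p : ℂ) (j : ℕ) :
    ellFac x q p (2 * j) = ellFac x (q ^ 2) p j * ellFac (x * q) (q ^ 2) p j := by
  induction j with
  | zero => simp [ellFac_zero]
  | succ j ih =>
    rw [show 2 * (j + 1) = 2 * j + 1 + 1 by ring, ellFac_succ (y := x * q * (q ^ 2) ^ j) (by ring),
      ellFac_succ (y := x * (q ^ 2) ^ j) (by ring), ih, ellFac_succ rfl, ellFac_succ rfl]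
    ring

/-- Here `x' = q^(1-l)/x` and `y' = q^(1-l)/y`. Reading the product of `x'` backwards and inverting
each theta argument gives the product of `x` times `x^(-l)` and a factor depending only on `q` and
`l`. That factor cancels when two such reversals are compared. -/
theorem ellFac_reverse {x y q p : ℂ} (hp : ‖p‖ < 1) (hq : q ≠ 0) (hx : x ≠ 0) (hy : y ≠ 0)
    {l : ℕ} {x' y' : ℂ} (hx' : x' * x * q ^ l = q) (hy' : y' * y * q ^ l = q) :
    ellFac x q p l * ellFac y' q p l * y ^ l = ellFac y q p l * ellFac x' q p l * x ^ l := by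
  have key : ∀ w w' : ℂ, w ≠ 0 → w' * w * q ^ l = q → ellFac w' q p l * w ^ l =
      (∏ j ∈ Finset.range l, (-(q ^ j)⁻¹)) * ellFac w q p l := fun w w' hw h => by
    have hpow : w ^ l = ∏ _j ∈ Finset.range l, w := by simp
    rw [ellFac, ← Finset.prod_range_reflect, ellFac, ← Finset.prod_mul_distrib, hpow,
      ← Finset.prod_mul_distrib]
    refine Finset.prod_congr rfl fun j hj => ?_
    have hj := Finset.mem_range.1 hj
    obtain ⟨i, rfl⟩ : ∃ i, l = i + j + 1 := ⟨l - (j + 1), by omega⟩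
    have hwq : w * q ^ j ≠ 0 := mul_ne_zero hw (pow_ne_zero _ hq)
    have h2 : w' * q ^ (i + j + 1 - 1 - j) = (w * q ^ j)⁻¹ := by
      rw [show i + j + 1 - 1 - j = i by omega]
      apply eq_inv_of_mul_eq_one_left
      apply mul_right_cancel₀ hq
      linear_combination h
    rw [h2, theta_inv hwq hp]
    field_simp
  calc ellFac x q p l * ellFac y' q p l * y ^ l = ellFac x q p l * (ellFac y' q p l * y ^ l) := by
        ring
    _ = ellFac y q p l * (ellFac x' q p l * x ^ l) := by rw [key y y' hy hy', key x x' hx hx']; ring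
    _ = _ := by ring

theorem ThetaGeneric.inv {q p x y : ℂ} (hp : ‖p‖ < 1) (hq : q ≠ 0) (hx : x ≠ 0)
    (h : ThetaGeneric q p x) (hy : x⁻¹ = y) : ThetaGeneric q p y := fun i => by
  have h0 : x * q ^ (-i) ≠ 0 := mul_ne_zero hx (zpow_ne_zero _ hq)
  have h1 : y * q ^ i = (x * q ^ (-i))⁻¹ := by
    rw [← hy, mul_inv, zpow_neg, inv_inv]
  rw [h1, theta_inv h0 hp]
  exact div_ne_zero (neg_ne_zero.2 (h (-i))) h0

theorem ThetaGeneric.sq {q p x y : ℂ} (hq : q ≠ 0) (h : ThetaGeneric q p x) (i : ℤ)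
    (hy : x * q ^ i = y) : ThetaGeneric (q ^ 2) p y := fun j => by
  rw [← hy, ← zpow_natCast q 2, ← zpow_mul, mul_assoc, ← zpow_add₀ hq]
  exact h _

/-- The part of the expansion coefficients that is summed by the Frenkel–Turaev sum in
base `q ^ 2`. -/
noncomputable def innerTerm (a m q p : ℂ) (s j : ℕ) : ℂ :=
  theta (a * q ^ (4 * j)) p / theta a p *
    (ellFac a (q ^ 2) p j * ellFac (a ^ 2 / m ^ 2) (q ^ 2) p j * ellFac (m * q ^ s) q p (2 * j) *
        ellFac (q ^ s)⁻¹ q p (2 * j) * q ^ (2 * j) /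
      (ellFac (q ^ 2) (q ^ 2) p j * ellFac (m ^ 2 * q ^ 2 / a) (q ^ 2) p j *
        ellFac (a * q / (m * q ^ s)) q p (2 * j) * ellFac (a * q ^ (s + 1)) q p (2 * j)))

/-- The closed form of the sum of `innerTerm a m q p s`. -/
noncomputable def innerSum (a m q p : ℂ) (s : ℕ) : ℂ :=
  ellFac (a * q) q p s * ellFac (a / m) q p s * ellFac (m ^ 2 * q / a) (q ^ 2) p s *
      (-(m / a)) ^ s /
    (ellFac (m / a) q p s * ellFac (m ^ 2 * q / a) q p s * ellFac (a * q) (q ^ 2) p s)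

section
variable {a m q p : ℂ}

/-- For `s = 2N`, the parameter `q^(-s) = (q²)^(-N)` terminates the series in base `q²`, and
`q^(1-s)` is the free parameter `d`. -/
theorem sum_innerTerm_even (hp0 : p ≠ 0) (hp : ‖p‖ < 1) (hq : q ≠ 0) (ha : a ≠ 0) (hm : m ≠ 0)
    {N : ℕ} (hqs : ∀ i < 2 * N, theta (q * q ^ i) p ≠ 0) (gA : ThetaGeneric q p a)
    (gma : ThetaGeneric q p (m / a)) (gam : ThetaGeneric q p (a / m))
    (gmma : ThetaGeneric q p (m ^ 2 / a)) :
    ∑ j ∈ Finset.range (N + 1), innerTerm a m q p (2 * N) j = innerSum a m q p (2 * N) := by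
  have hq2 : q ^ 2 ≠ 0 := pow_ne_zero 2 hq
  have hft := sum_ftTerm (N := N) (a := a) (b := a ^ 2 / m ^ 2) (c := m * q ^ (2 * N))
    (d := q / q ^ (2 * N)) (e := m * q ^ (2 * N + 1)) hp0 hp hq2 ha (by positivity)
    (by positivity) (by positivity) (by field_simp; ring)
    -- The base `q²` only needs the even powers of `q`: `(q²)^(i+1) = q * q^(2i+1)`.
    (fun i hi => by
      have := hqs (2 * i + 1) (by omega)
      rwa [show q * q ^ (2 * i + 1) = q ^ 2 * (q ^ 2) ^ i by ring] at this)
    (gA.sq hq 0 (by simp)) (gmma.sq hq 0 (by rw [zpow_zero]; field_simp))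
    (gam.sq hq (-(2 * N : ℕ)) (by rw [zpow_neg, zpow_natCast]; field_simp))
    (gA.sq hq (2 * N - 1) (by rw [zpow_sub_one₀ hq]; norm_cast; field_simp))
    (gma.sq hq (-1) (by rw [zpow_neg_one]; field_simp))
    (gam.sq hq (-(2 * N + 1 : ℕ)) (by rw [zpow_neg, zpow_natCast]; field_simp))
  have hterm : ∀ j, innerTerm a m q p (2 * N) j = ftTerm N a (a ^ 2 / m ^ 2) (m * q ^ (2 * N))
      (q / q ^ (2 * N)) (m * q ^ (2 * N + 1)) (q ^ 2) p j := fun j => by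
    rw [innerTerm, ftTerm]
    simp only [ellFac_two_mul]
    rw [show a * q ^ 2 / (a ^ 2 / m ^ 2) = m ^ 2 * q ^ 2 / a by field_simp,
      show a * (q ^ 2) ^ (2 * j) = a * q ^ (4 * j) by ring,
      show (q ^ 2) ^ j = q ^ (2 * j) by ring,
      show ((q ^ 2) ^ N)⁻¹ = (q ^ (2 * N))⁻¹ by rw [pow_mul],
      show (q ^ (2 * N))⁻¹ * q = q / q ^ (2 * N) by ring,
      show m * q ^ (2 * N) * q = m * q ^ (2 * N + 1) by ring,
      show a * q / (m * q ^ (2 * N)) = a * q ^ 2 / (m * q ^ (2 * N + 1)) by field_simp; ring,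
      show a * q ^ 2 / (m * q ^ (2 * N + 1)) * q = a * q ^ 2 / (m * q ^ (2 * N)) by field_simp; ring,
      show a * q ^ 2 / (q / q ^ (2 * N)) = a * q ^ (2 * N + 1) by field_simp; ring,
      show a * q ^ (2 * N + 1) * q = a * (q ^ 2) ^ (N + 1) by ring]
    ring
  rw [Finset.sum_congr rfl fun j _ => hterm j, hft]
  have hfac : ∀ {x y : ℂ}, ThetaGeneric q p x → ∀ i : ℤ, x * q ^ i = y → ∀ n,
    ellFac y (q ^ 2) p n ≠ 0 := fun h i hy n => (h.sq hq i hy).ellFac_ne_zero hq2 0 (by simp) n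
  -- The closed form contains `m q^(2-2N)/a`, whereas `innerSum` contains `a/m`; reversal exchanges
  -- them and produces the power of `m/a`.
  have hrev := ellFac_reverse (q := q ^ 2) (x := a / m) (y := m / a) (x' := m * q ^ 2 / (a * q ^ (2 * N)))
    (y' := a * q ^ 2 / (m * q ^ (2 * N))) (l := N) hp hq2 (by positivity) (by positivity)
    (by rw [← pow_mul]; field_simp) (by rw [← pow_mul]; field_simp)
  have h1 : ellFac (a * q) (q ^ 2) p (2 * N) =
      ellFac (a * q) (q ^ 2) p N * ellFac (a * q ^ (2 * N + 1)) (q ^ 2) p N := by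
    nth_rw 1 [two_mul]
    exact ellFac_add N (by ring)
  have h2 : ellFac (m ^ 2 * q / a) (q ^ 2) p (2 * N) =
      ellFac (m ^ 2 * q / a) (q ^ 2) p N * ellFac (m ^ 2 * q ^ (2 * N + 1) / a) (q ^ 2) p N := by
    nth_rw 1 [two_mul]
    exact ellFac_add N (by ring)
  have n1 : ellFac (m ^ 2 * q ^ 2 / a) (q ^ 2) p N ≠ 0 := hfac gmma 2 (by norm_cast; ring) N
  have n2 : ellFac (m ^ 2 * q / a) (q ^ 2) p N ≠ 0 := hfac gmma 1 (by rw [zpow_one]; ring) N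
  have n3 : ellFac (a * q ^ 2 / (m * q ^ (2 * N))) (q ^ 2) p N ≠ 0 :=
    hfac gam (2 - (2 * N : ℕ)) (by rw [zpow_sub₀ hq]; norm_cast; field_simp) N
  have n4 : ellFac (a * q ^ (2 * N + 1)) (q ^ 2) p N ≠ 0 := hfac gA (2 * N + 1 : ℕ) (by norm_cast) N
  have n5 : ellFac (m * q / a) (q ^ 2) p N ≠ 0 := hfac gma 1 (by rw [zpow_one]; ring) N
  have n6 : ellFac (m / a) (q ^ 2) p N ≠ 0 := hfac gma 0 (by simp) N
  have n7 : ellFac (a * q) (q ^ 2) p N ≠ 0 := hfac gA 1 (by simp) N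
  rw [ftSum, innerSum, h1, h2, ellFac_two_mul, ellFac_two_mul, ellFac_two_mul, ellFac_two_mul]
  rw [show a * q ^ 2 / (a ^ 2 / m ^ 2) = m ^ 2 * q ^ 2 / a by field_simp,
    show a * q ^ 2 / (a ^ 2 / m ^ 2 * (m * q ^ (2 * N))) = m * q ^ 2 / (a * q ^ (2 * N)) by field_simp,
    show a * q ^ 2 / (a ^ 2 / m ^ 2 * (q / q ^ (2 * N))) = m ^ 2 * q ^ (2 * N + 1) / a by field_simp; ring,
    show a * q ^ 2 / (m * q ^ (2 * N) * (q / q ^ (2 * N))) = a * q / m by field_simp,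
    show a * q ^ 2 / (q / q ^ (2 * N)) = a * q ^ (2 * N + 1) by field_simp; ring,
    show a * q ^ 2 / (a ^ 2 / m ^ 2 * (m * q ^ (2 * N)) * (q / q ^ (2 * N))) = m * q / a by field_simp,
    show a * q * q = a * q ^ 2 by ring, show a / m * q = a * q / m by ring,
    show m / a * q = m * q / a by ring, show m ^ 2 * q / a * q = m ^ 2 * q ^ 2 / a by ring,
    Even.neg_pow (even_two_mul N)]
  have h3 : ellFac (m * q ^ 2 / (a * q ^ (2 * N))) (q ^ 2) p N =
      ellFac (a / m) (q ^ 2) p N * ellFac (a * q ^ 2 / (m * q ^ (2 * N))) (q ^ 2) p N *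
        (m / a) ^ (2 * N) / ellFac (m / a) (q ^ 2) p N := by
    have : (a / m) ^ N * (m / a) ^ N = 1 := by
      rw [← mul_pow, div_mul_div_cancel₀ hm, div_self ha, one_pow]
    rw [eq_div_iff n6, show (m / a) ^ (2 * N) = (m / a) ^ N * (m / a) ^ N by ring]
    linear_combination (-(m / a) ^ N) * hrev -
      ellFac (m / a) (q ^ 2) p N * ellFac (m * q ^ 2 / (a * q ^ (2 * N))) (q ^ 2) p N * this
  rw [h3]
  clear h1 h2 h3 hrev hfac hterm hft gA gma gam gmma hqs
  generalize (m / a) ^ (2 * N) = Z at *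
  generalize ellFac (m / a) (q ^ 2) p N = X1 at *
  generalize ellFac (a / m) (q ^ 2) p N = X2 at *
  generalize ellFac (a * q ^ 2 / (m * q ^ (2 * N))) (q ^ 2) p N = X3 at *
  generalize ellFac (a * q) (q ^ 2) p N = X4 at *
  generalize ellFac (m * q / a) (q ^ 2) p N = X5 at *
  generalize ellFac (a * q ^ (2 * N + 1)) (q ^ 2) p N = X6 at *
  generalize ellFac (m ^ 2 * q ^ 2 / a) (q ^ 2) p N = X7 at *
  generalize ellFac (m ^ 2 * q / a) (q ^ 2) p N = X8 at *
  simp only [mul_div_assoc', div_mul_eq_mul_div, div_div]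
  rw [div_eq_div_iff (by simp [*]) (by simp [*])]
  ring

/-- For `s = 2N + 1` the two roles are exchanged: `q^(1-s) = (q²)^(-N)` terminates the series and
`q^(-s)` becomes `d`. The closed form is nevertheless the same expression in `s`. -/
theorem sum_innerTerm_odd (hp0 : p ≠ 0) (hp : ‖p‖ < 1) (hq : q ≠ 0) (ha : a ≠ 0) (hm : m ≠ 0)
    {N : ℕ} (hqs : ∀ i < 2 * N + 1, theta (q * q ^ i) p ≠ 0) (gA : ThetaGeneric q p a)
    (gma : ThetaGeneric q p (m / a)) (gam : ThetaGeneric q p (a / m))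
    (gmma : ThetaGeneric q p (m ^ 2 / a)) :
    ∑ j ∈ Finset.range (N + 1), innerTerm a m q p (2 * N + 1) j =
      innerSum a m q p (2 * N + 1) := by
  have hq2 : q ^ 2 ≠ 0 := pow_ne_zero 2 hq
  have hft := sum_ftTerm (N := N) (a := a) (b := a ^ 2 / m ^ 2) (c := m * q ^ (2 * N + 1))
    (d := 1 / q ^ (2 * N + 1)) (e := m * q ^ (2 * N + 2)) hp0 hp hq2 ha (by positivity)
    (by positivity) (one_div_ne_zero (by positivity)) (by field_simp; ring)
    (fun i hi => by
      have := hqs (2 * i + 1) (by omega)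
      rwa [show q * q ^ (2 * i + 1) = q ^ 2 * (q ^ 2) ^ i by ring] at this)
    (gA.sq hq 0 (by simp)) (gmma.sq hq 0 (by rw [zpow_zero]; field_simp))
    (gam.sq hq (-(2 * N + 1 : ℕ)) (by rw [zpow_neg, zpow_natCast]; field_simp))
    (gA.sq hq (2 * N + 1 : ℕ) (by rw [zpow_natCast]; field_simp))
    (gma.sq hq 0 (by rw [zpow_zero]; field_simp))
    (gam.sq hq (-(2 * N + 2 : ℕ)) (by rw [zpow_neg, zpow_natCast]; field_simp))
  have hterm : ∀ j, innerTerm a m q p (2 * N + 1) j = ftTerm N a (a ^ 2 / m ^ 2)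
      (m * q ^ (2 * N + 1)) (1 / q ^ (2 * N + 1)) (m * q ^ (2 * N + 2)) (q ^ 2) p j := fun j => by
    rw [innerTerm, ftTerm]
    simp only [ellFac_two_mul]
    rw [show a * q ^ 2 / (a ^ 2 / m ^ 2) = m ^ 2 * q ^ 2 / a by field_simp,
      show a * (q ^ 2) ^ (2 * j) = a * q ^ (4 * j) by ring,
      show (q ^ 2) ^ j = q ^ (2 * j) by ring,
      show ((q ^ 2) ^ N)⁻¹ = (q ^ (2 * N + 1))⁻¹ * q by rw [← pow_mul]; field_simp; ring,
      show m * q ^ (2 * N + 1) * q = m * q ^ (2 * N + 2) by ring,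
      show a * q / (m * q ^ (2 * N + 1)) = a * q ^ 2 / (m * q ^ (2 * N + 2)) by field_simp; ring,
      show a * q ^ 2 / (m * q ^ (2 * N + 2)) * q = a * q ^ 2 / (m * q ^ (2 * N + 1)) by field_simp; ring,
      show a * q ^ 2 / (1 / q ^ (2 * N + 1)) = a * q ^ (2 * N + 1 + 1) * q by field_simp; ring,
      show a * (q ^ 2) ^ (N + 1) = a * q ^ (2 * N + 1 + 1) by ring, one_div]
    ring
  rw [Finset.sum_congr rfl fun j _ => hterm j, hft]
  have hfac : ∀ {x y : ℂ}, ThetaGeneric q p x → ∀ i : ℤ, x * q ^ i = y → ∀ n,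
    ellFac y (q ^ 2) p n ≠ 0 := fun h i hy n => (h.sq hq i hy).ellFac_ne_zero hq2 0 (by simp) n
  have hrev := ellFac_reverse (q := q ^ 2) (x := a * q / m) (y := m * q / a)
    (x' := m * q ^ 2 / (a * q ^ (2 * N + 1)))
    (y' := a * q ^ 2 / (m * q ^ (2 * N + 1))) (l := N) hp hq2 (by positivity) (by positivity)
    (by rw [← pow_mul]; field_simp; ring) (by rw [← pow_mul]; field_simp; ring)
  have h1 : ellFac (a * q) (q ^ 2) p (2 * N + 1) =
      ellFac (a * q) (q ^ 2) p (N + 1) * ellFac (a * q ^ (2 * N + 3)) (q ^ 2) p N := by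
    rw [show 2 * N + 1 = N + 1 + N by ring]
    exact ellFac_add N (by ring)
  have h2 : ellFac (m ^ 2 * q / a) (q ^ 2) p (2 * N + 1) =
      ellFac (m ^ 2 * q / a) (q ^ 2) p (N + 1) *
        ellFac (m ^ 2 * q ^ (2 * N + 3) / a) (q ^ 2) p N := by
    rw [show 2 * N + 1 = N + 1 + N by ring]
    exact ellFac_add N (by ring)
  have hodd : ∀ x y z : ℂ, x * q = y → x * q ^ 2 = z → ellFac x q p (2 * N + 1) =
      theta x p * (ellFac y (q ^ 2) p N * ellFac z (q ^ 2) p N) := fun x y z h h' => by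
    rw [ellFac_succ' _ h, ellFac_two_mul]
    congr 3
    rw [← h, ← h']
    ring
  have hodd' : ∀ x y : ℂ, x * q = y → ellFac x q p (2 * N + 1) =
      ellFac x (q ^ 2) p (N + 1) * ellFac y (q ^ 2) p N := fun x y h => by
    rw [ellFac_succ rfl, ellFac_two_mul, ellFac_succ (y := x * q ^ (2 * N)) (by ring), h]
    ring
  have n1 : ellFac (m ^ 2 * q ^ 2 / a) (q ^ 2) p N ≠ 0 := hfac gmma 2 (by norm_cast; ring) N
  have n2 : ellFac (m ^ 2 * q / a) (q ^ 2) p (N + 1) ≠ 0 := hfac gmma 1 (by rw [zpow_one]; ring) _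
  have n3 : ellFac (a * q ^ 2 / (m * q ^ (2 * N + 1))) (q ^ 2) p N ≠ 0 :=
    hfac gam (2 - (2 * N + 1 : ℕ)) (by rw [zpow_sub₀ hq, zpow_natCast]; norm_cast; field_simp) N
  have n4 : ellFac (a * q ^ (2 * N + 3)) (q ^ 2) p N ≠ 0 := hfac gA (2 * N + 3 : ℕ) (by norm_cast) N
  have n5 : ellFac (m * q / a) (q ^ 2) p N ≠ 0 := hfac gma 1 (by rw [zpow_one]; ring) N
  have n6 : ellFac (m * q ^ 2 / a) (q ^ 2) p N ≠ 0 := hfac gma 2 (by norm_cast; ring) N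
  have n7 : ellFac (a * q) (q ^ 2) p (N + 1) ≠ 0 := hfac gA 1 (by simp) _
  have n8 : theta (m / a) p ≠ 0 := gma.theta_ne_zero 0 (by simp)
  have hma : m / a ≠ 0 := div_ne_zero hm ha
  rw [ftSum, innerSum, h1, h2, hodd' (a * q) (a * q ^ 2) (by ring),
    hodd (a / m) (a * q / m) (a * q ^ 2 / m) (by ring) (by ring),
    hodd (m / a) (m * q / a) (m * q ^ 2 / a) (by ring) (by ring),
    hodd' (m ^ 2 * q / a) (m ^ 2 * q ^ 2 / a) (by ring)]
  rw [show a * q ^ 2 / (a ^ 2 / m ^ 2) = m ^ 2 * q ^ 2 / a by field_simp,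
    show a * q ^ 2 / (a ^ 2 / m ^ 2 * (m * q ^ (2 * N + 1))) = m * q ^ 2 / (a * q ^ (2 * N + 1)) by
      field_simp,
    show a * q ^ 2 / (a ^ 2 / m ^ 2 * (1 / q ^ (2 * N + 1))) = m ^ 2 * q ^ (2 * N + 3) / a by
      field_simp; ring,
    show a * q ^ 2 / (m * q ^ (2 * N + 1) * (1 / q ^ (2 * N + 1))) = a * q ^ 2 / m by field_simp,
    show a * q ^ 2 / (1 / q ^ (2 * N + 1)) = a * q ^ (2 * N + 3) by field_simp; ring,
    show a * q ^ 2 / (a ^ 2 / m ^ 2 * (m * q ^ (2 * N + 1)) * (1 / q ^ (2 * N + 1))) =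
      m * q ^ 2 / a by field_simp,
    -- The unpaired factor `θ(a/m)/θ(m/a) = -m/a` accounts for the sign in `(-(m/a))^s`.
    show a / m = (m / a)⁻¹ by field_simp, theta_inv hma hp,
    Odd.neg_pow (odd_two_mul_add_one N), pow_succ (m / a)]
  have h3 : ellFac (m * q ^ 2 / (a * q ^ (2 * N + 1))) (q ^ 2) p N =
      ellFac (a * q / m) (q ^ 2) p N * ellFac (a * q ^ 2 / (m * q ^ (2 * N + 1))) (q ^ 2) p N *
        (m / a) ^ (2 * N) / ellFac (m * q / a) (q ^ 2) p N := by
    have h4 : (m * q / a) ^ N = (a * q / m) ^ N * (m / a) ^ (2 * N) := by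
      rw [pow_mul, ← mul_pow]
      congr 1
      field_simp
    have h5 : (a * q / m) ^ N ≠ 0 := by positivity
    rw [eq_div_iff n5]
    apply mul_right_cancel₀ h5
    rw [h4] at hrev
    linear_combination -hrev
  rw [h3]
  clear h1 h2 h3 hrev hfac hterm hft gA gma gam gmma hqs hodd hodd'
  generalize (m / a) ^ (2 * N) = Z at *
  generalize theta (m / a) p = X0 at *
  generalize ellFac (m * q / a) (q ^ 2) p N = X1 at *
  generalize ellFac (a * q / m) (q ^ 2) p N = X2 at *
  generalize ellFac (a * q ^ 2 / (m * q ^ (2 * N + 1))) (q ^ 2) p N = X3 at *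
  generalize ellFac (a * q) (q ^ 2) p (N + 1) = X4 at *
  generalize ellFac (m * q ^ 2 / a) (q ^ 2) p N = X5 at *
  generalize ellFac (a * q ^ (2 * N + 3)) (q ^ 2) p N = X6 at *
  generalize ellFac (m ^ 2 * q ^ 2 / a) (q ^ 2) p N = X7 at *
  generalize ellFac (m ^ 2 * q / a) (q ^ 2) p (N + 1) = X8 at *
  generalize m / a = w at *
  simp only [mul_div_assoc', div_mul_eq_mul_div, div_div]
  rw [div_eq_div_iff (by simp [*]) (by simp [*])]
  ring

theorem sum_innerTerm (hp0 : p ≠ 0) (hp : ‖p‖ < 1) (hq : q ≠ 0) (ha : a ≠ 0) (hm : m ≠ 0)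
    {s : ℕ} (hqs : ∀ i < s, theta (q * q ^ i) p ≠ 0) (gA : ThetaGeneric q p a)
    (gma : ThetaGeneric q p (m / a)) (gmma : ThetaGeneric q p (m ^ 2 / a)) :
    ∑ j ∈ Finset.range (s / 2 + 1), innerTerm a m q p s j = innerSum a m q p s := by
  have gam : ThetaGeneric q p (a / m) := gma.inv hp hq (div_ne_zero hm ha) (inv_div _ _)
  rcases Nat.even_or_odd' s with ⟨N, rfl | rfl⟩
  · rw [show 2 * N / 2 = N by omega]
    exact sum_innerTerm_even hp0 hp hq ha hm hqs gA gma gam gmma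
  · rw [show (2 * N + 1) / 2 = N by omega]
    exact sum_innerTerm_odd hp0 hp hq ha hm hqs gA gma gam gmma

end

/-! ### Expansion into a double sum and exchange of summation -/

/-- The general term of the series on the left of the quadratic transformation, with the
factorials in base `q ^ 2` combined in pairs. -/
noncomputable def quadTerm (n : ℕ) (a b c k m q p : ℂ) (j : ℕ) : ℂ :=
  theta (a * q ^ (4 * j)) p / theta a p *
    (ellFac a (q ^ 2) p j * ellFac (a ^ 2 / m ^ 2) (q ^ 2) p j * ellFac b q p (2 * j) *
        ellFac c q p (2 * j) * ellFac (k * q ^ n) q p (2 * j) * ellFac (q ^ n)⁻¹ q p (2 * j) *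
        q ^ (2 * j) /
      (ellFac (q ^ 2) (q ^ 2) p j * ellFac (m ^ 2 * q ^ 2 / a) (q ^ 2) p j *
        ellFac (a * q / b) q p (2 * j) * ellFac (a * q / c) q p (2 * j) *
        ellFac (a * q / (k * q ^ n)) q p (2 * j) * ellFac (a * q ^ (n + 1)) q p (2 * j)))

/-- The factor of the expansion coefficients that only depends on the outer index. -/
noncomputable def outerTerm (n : ℕ) (a b c k m q p : ℂ) (s : ℕ) : ℂ :=
  theta (m * q ^ (2 * s)) p / theta m p *
    (ellFac m q p s * ellFac b q p s * ellFac c q p s * ellFac (k * q ^ n) q p s *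
        ellFac (q ^ n)⁻¹ q p s * ellFac (m / a) q p s * q ^ s /
      (ellFac q q p s * ellFac (a * q) q p s * ellFac (m * q / b) q p s *
        ellFac (m * q / c) q p s * ellFac (m * q / (k * q ^ n)) q p s *
        ellFac (m * q ^ (n + 1)) q p s))

/-- The prefactor of the quadratic transformation. -/
noncomputable def quadPrefactor (n : ℕ) (a b c k m q p : ℂ) : ℂ :=
  ellFac (a * q) q p n * ellFac (k / m) q p n * ellFac (m * q / b) q p n *
      ellFac (m * q / c) q p n /
    (ellFac (m * q) q p n * ellFac (k / a) q p n * ellFac (a * q / b) q p n *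
      ellFac (a * q / c) q p n)

/-- The genericity assumptions under which the quadratic transformation is first proved. -/
structure QuadGeneric (a b c k m q p : ℂ) : Prop where
  ga : ThetaGeneric q p a
  gm : ThetaGeneric q p m
  gma : ThetaGeneric q p (m / a)
  gmma : ThetaGeneric q p (m ^ 2 / a)
  gmb : ThetaGeneric q p (m / b)
  gmc : ThetaGeneric q p (m / c)
  gmk : ThetaGeneric q p (m / k)
  gba : ThetaGeneric q p (b / a)
  gca : ThetaGeneric q p (c / a)
  gka : ThetaGeneric q p (k / a)

section
variable {n : ℕ} {a b c k m q p : ℂ}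

/-- The prefactor is what makes the closed form of the expanding sum collapse to factorials of
lengths `2j` and `4j`. The same product appears in `quadTerm_mul_ftTerm`, so that it can be replaced
by the prefactor times the sum. -/
theorem quadPrefactor_mul_ftSum (hp : ‖p‖ < 1) (hq : q ≠ 0) (ha : a ≠ 0) (hb : b ≠ 0)
    (hc : c ≠ 0) (hk : k ≠ 0) (hm : m = b * c * k / (a * q)) (g : QuadGeneric a b c k m q p)
    {j N : ℕ} (hn : n = N + 2 * j) :
    quadPrefactor n a b c k m q p * ftSum N (m * q ^ (4 * j)) (b * q ^ (2 * j)) (c * q ^ (2 * j))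
        (k * q ^ (n + 2 * j)) q p =
      ellFac (a * q) q p (4 * j) / ellFac (m * q) q p (4 * j) * (a / m) ^ (2 * j) *
        (ellFac (m * q / b) q p (2 * j) * ellFac (m * q / c) q p (2 * j) *
          ellFac (m * q / (k * q ^ n)) q p (2 * j) * ellFac (m * q ^ (n + 1)) q p (2 * j)) /
        (ellFac (a * q / b) q p (2 * j) * ellFac (a * q / c) q p (2 * j) *
          ellFac (a * q / (k * q ^ n)) q p (2 * j) * ellFac (a * q ^ (n + 1)) q p (2 * j)) := by
  have hm0 : m ≠ 0 := hm ▸ by positivity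
  have hfac : ∀ {x y : ℂ}, ThetaGeneric q p x → ∀ i : ℤ, x * q ^ i = y → ∀ n,
    ellFac y q p n ≠ 0 := fun h i hy n => h.ellFac_ne_zero hq i hy n
  have hbck : b * c * k = m * a * q := by rw [hm]; field_simp
  have gab : ThetaGeneric q p (a / b) := g.gba.inv hp hq (div_ne_zero hb ha) (inv_div _ _)
  have gac : ThetaGeneric q p (a / c) := g.gca.inv hp hq (div_ne_zero hc ha) (inv_div _ _)
  have gak : ThetaGeneric q p (a / k) := g.gka.inv hp hq (div_ne_zero hk ha) (inv_div _ _)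
  have gkm : ThetaGeneric q p (k / m) := g.gmk.inv hp hq (div_ne_zero hm0 hk) (inv_div _ _)
  have s1 : ellFac (m * q) q p n * ellFac (m * q ^ (n + 1)) q p (2 * j) =
      ellFac (m * q) q p (4 * j) * ellFac (m * q ^ (4 * j) * q) q p N := by
    rw [← ellFac_add (2 * j) (by ring), ← ellFac_add N (by ring), hn]
    congr 1
    ring
  have s2 : ellFac (a * q) q p n * ellFac (a * q ^ (n + 1)) q p (2 * j) =
      ellFac (a * q) q p (4 * j) * ellFac (a * q ^ (4 * j + 1)) q p N := by
    rw [← ellFac_add (2 * j) (by ring), ← ellFac_add N (by ring), hn]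
    congr 1
    ring
  have s3 : ∀ x y z : ℂ, x * q / y * q ^ (2 * j) = z → ellFac (x * q / y) q p n =
      ellFac (x * q / y) q p (2 * j) * ellFac z q p N := fun x y z h => by
    rw [← ellFac_add N h, hn, add_comm]
  have s4 : ∀ x : ℂ, ellFac (k / x) q p n =
      ellFac (k / x) q p N * ellFac (k * q ^ N / x) q p (2 * j) := fun x => by
    rw [hn, ellFac_add (y := k * q ^ N / x) (2 * j) (by ring)]
  have r1 := ellFac_reverse (q := q) (x := k * q ^ N / a) (y := k * q ^ N / m)
    (x' := a * q / (k * q ^ n)) (y' := m * q / (k * q ^ n)) (l := 2 * j) hp hq (by positivity)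
    (by positivity) (by rw [hn, pow_add]; field_simp) (by rw [hn, pow_add]; field_simp)
  have r2 := ellFac_reverse (q := q) (x := c / (a * q ^ n)) (y := m * q ^ (2 * j + 1) / (k * q ^ n))
    (x' := a * q ^ (2 * j + 1) / c) (y' := k / m) (l := N) hp hq (by positivity)
    (by positivity) (by rw [hn, pow_add]; field_simp; ring) (by rw [hn, pow_add]; field_simp; ring)
  have r3 := ellFac_reverse (q := q) (x := b / (a * q ^ n)) (y := 1 / (a * q ^ (n + 2 * j)))
    (x' := a * q ^ (2 * j + 1) / b) (y' := a * q ^ (4 * j + 1)) (l := N) hp hq (by positivity)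
    (one_div_ne_zero (by positivity)) (by rw [hn, pow_add]; field_simp; ring) (by rw [hn]; field_simp; ring)
  -- The powers created by the reversals `r2` and `r3` cancel only jointly, by the relation `m a q =
  -- b c k`.
  have hpow : (m * q ^ (2 * j + 1) / (k * q ^ n)) ^ N * (1 / (a * q ^ (n + 2 * j))) ^ N =
      (c / (a * q ^ n)) ^ N * (b / (a * q ^ n)) ^ N := by
    rw [← mul_pow, ← mul_pow]
    congr 1
    rw [hm]
    field_simp
    ring
  have hpow2 : (k * q ^ N / m) ^ (2 * j) = (k * q ^ N / a) ^ (2 * j) * (a / m) ^ (2 * j) := by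
    rw [← mul_pow]
    congr 1
    field_simp
  have n1 : ellFac (m * q) q p n ≠ 0 := hfac g.gm 1 (by simp) n
  have n2 : ellFac (m * q) q p (4 * j) ≠ 0 := hfac g.gm 1 (by simp) _
  have n3 : ellFac (m * q ^ (2 * j + 1) / b) q p N ≠ 0 :=
    hfac g.gmb (2 * j + 1 : ℕ) (by rw [zpow_natCast]; ring) _
  have n4 : ellFac (m * q ^ (2 * j + 1) / c) q p N ≠ 0 :=
    hfac g.gmc (2 * j + 1 : ℕ) (by rw [zpow_natCast]; ring) _
  have n5 : ellFac (m * q ^ (2 * j + 1) / (k * q ^ n)) q p N ≠ 0 :=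
    hfac g.gmk ((2 * j + 1 : ℕ) - (n : ℕ)) (by
      rw [zpow_sub₀ hq, zpow_natCast, zpow_natCast]; field_simp) _
  have n6 : ellFac (1 / (a * q ^ (n + 2 * j))) q p N ≠ 0 :=
    hfac (g.ga.inv hp hq ha rfl) (-(n + 2 * j : ℕ)) (by
      rw [zpow_neg, zpow_natCast]; field_simp) _
  have n7 : ellFac (a * q ^ (2 * j + 1) / b) q p N ≠ 0 :=
    hfac gab (2 * j + 1 : ℕ) (by rw [zpow_natCast]; ring) _
  have n8 : ellFac (a * q ^ (2 * j + 1) / c) q p N ≠ 0 :=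
    hfac gac (2 * j + 1 : ℕ) (by rw [zpow_natCast]; ring) _
  have n9 : ellFac (a * q / b) q p (2 * j) ≠ 0 := hfac gab 1 (by rw [zpow_one]; ring) _
  have n10 : ellFac (a * q / c) q p (2 * j) ≠ 0 := hfac gac 1 (by rw [zpow_one]; ring) _
  have n11 : ellFac (a * q / (k * q ^ n)) q p (2 * j) ≠ 0 :=
    hfac gak (1 - (n : ℕ)) (by rw [zpow_sub₀ hq, zpow_natCast]; field_simp) _
  have n12 : ellFac (a * q ^ (n + 1)) q p (2 * j) ≠ 0 := hfac g.ga (n + 1 : ℕ) (by norm_cast) _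
  have n13 : ellFac (k / a) q p N ≠ 0 := hfac g.gka 0 (by simp) _
  have n14 : ellFac (k * q ^ N / a) q p (2 * j) ≠ 0 :=
    hfac g.gka N (by rw [zpow_natCast]; ring) _
  have n15 : ellFac (k / m) q p N ≠ 0 := hfac gkm 0 (by simp) _
  have n16 : ellFac (a * q ^ (4 * j + 1)) q p N ≠ 0 := hfac g.ga (4 * j + 1 : ℕ) (by norm_cast) _
  have n17 : ellFac (m * q ^ (n + 1)) q p (2 * j) ≠ 0 := hfac g.gm (n + 1 : ℕ) (by norm_cast) _
  have n18 : (c / (a * q ^ n)) ^ N ≠ 0 := by positivity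
  have n19 : (b / (a * q ^ n)) ^ N ≠ 0 := by positivity
  have n20 : (k * q ^ N / a) ^ (2 * j) ≠ 0 := by positivity
  have hR23 : ellFac (c / (a * q ^ n)) q p N * ellFac (k / m) q p N *
      (ellFac (b / (a * q ^ n)) q p N * ellFac (a * q ^ (4 * j + 1)) q p N) =
      ellFac (m * q ^ (2 * j + 1) / (k * q ^ n)) q p N * ellFac (a * q ^ (2 * j + 1) / c) q p N *
      (ellFac (1 / (a * q ^ (n + 2 * j))) q p N * ellFac (a * q ^ (2 * j + 1) / b) q p N) := by
    apply mul_right_cancel₀ (mul_ne_zero n18 n19)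
    linear_combination
      r2 * (ellFac (b / (a * q ^ n)) q p N * ellFac (a * q ^ (4 * j + 1)) q p N *
        (1 / (a * q ^ (n + 2 * j))) ^ N) +
      ellFac (m * q ^ (2 * j + 1) / (k * q ^ n)) q p N * ellFac (a * q ^ (2 * j + 1) / c) q p N *
        (c / (a * q ^ n)) ^ N * r3 -
      ellFac (c / (a * q ^ n)) q p N * ellFac (k / m) q p N *
        (ellFac (b / (a * q ^ n)) q p N * ellFac (a * q ^ (4 * j + 1)) q p N) * hpow
  have hR1 : ellFac (k * q ^ N / a) q p (2 * j) * ellFac (m * q / (k * q ^ n)) q p (2 * j) *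
      (a / m) ^ (2 * j) =
      ellFac (k * q ^ N / m) q p (2 * j) * ellFac (a * q / (k * q ^ n)) q p (2 * j) := by
    apply mul_right_cancel₀ n20
    rw [hpow2] at r1
    linear_combination r1
  rw [← eq_div_iff n17] at s1
  rw [← eq_div_iff n12] at s2
  rw [quadPrefactor, ftSum, s4 m, s4 a, s3 m b (m * q ^ (2 * j + 1) / b) (by ring),
    s3 m c (m * q ^ (2 * j + 1) / c) (by ring), s3 a b (a * q ^ (2 * j + 1) / b) (by ring),
    s3 a c (a * q ^ (2 * j + 1) / c) (by ring), s1, s2]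
  rw [show m * q ^ (4 * j) * q / (b * q ^ (2 * j) * (c * q ^ (2 * j))) = k / a by
      rw [hm]; field_simp; ring,
    show m * q ^ (4 * j) * q / (b * q ^ (2 * j) * (k * q ^ (n + 2 * j))) = c / (a * q ^ n) by
      rw [hm, pow_add]; field_simp; ring,
    show m * q ^ (4 * j) * q / (c * q ^ (2 * j) * (k * q ^ (n + 2 * j))) = b / (a * q ^ n) by
      rw [hm, pow_add]; field_simp; ring,
    show m * q ^ (4 * j) * q / (b * q ^ (2 * j)) = m * q ^ (2 * j + 1) / b by field_simp; ring,
    show m * q ^ (4 * j) * q / (c * q ^ (2 * j)) = m * q ^ (2 * j + 1) / c by field_simp; ring,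
    show m * q ^ (4 * j) * q / (k * q ^ (n + 2 * j)) = m * q ^ (2 * j + 1) / (k * q ^ n) by
      rw [pow_add]; field_simp; ring,
    show m * q ^ (4 * j) * q / (b * q ^ (2 * j) * (c * q ^ (2 * j)) * (k * q ^ (n + 2 * j))) =
      1 / (a * q ^ (n + 2 * j)) by rw [hm]; field_simp; ring]
  have n21 : ellFac (m * q ^ (4 * j) * q) q p N ≠ 0 :=
    hfac g.gm (4 * j + 1 : ℕ) (by rw [zpow_natCast]; ring) _
  clear s1 s2 s3 s4 r1 r2 r3 hpow hpow2 hfac g n1 n15 n16 n18 n19 n20 hbck gab gac gak gkm hn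
  generalize ellFac (a * q) q p (4 * j) = X1 at *
  generalize ellFac (m * q) q p (4 * j) = X2 at *
  generalize ellFac (a * q ^ (4 * j + 1)) q p N = X3 at *
  generalize ellFac (a * q ^ (n + 1)) q p (2 * j) = X4 at *
  generalize ellFac (m * q ^ (4 * j) * q) q p N = X5 at *
  generalize ellFac (m * q ^ (n + 1)) q p (2 * j) = X6 at *
  generalize ellFac (k / m) q p N = X7 at *
  generalize ellFac (k * q ^ N / m) q p (2 * j) = X8 at *
  generalize ellFac (k / a) q p N = X9 at *
  generalize ellFac (k * q ^ N / a) q p (2 * j) = X10 at *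
  generalize ellFac (m * q / b) q p (2 * j) = X11 at *
  generalize ellFac (m * q / c) q p (2 * j) = X12 at *
  generalize ellFac (a * q / b) q p (2 * j) = X13 at *
  generalize ellFac (a * q / c) q p (2 * j) = X14 at *
  generalize ellFac (m * q / (k * q ^ n)) q p (2 * j) = X15 at *
  generalize ellFac (a * q / (k * q ^ n)) q p (2 * j) = X16 at *
  generalize ellFac (m * q ^ (2 * j + 1) / b) q p N = Y1 at *
  generalize ellFac (m * q ^ (2 * j + 1) / c) q p N = Y2 at *
  generalize ellFac (m * q ^ (2 * j + 1) / (k * q ^ n)) q p N = Y3 at *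
  generalize ellFac (1 / (a * q ^ (n + 2 * j))) q p N = Y4 at *
  generalize ellFac (a * q ^ (2 * j + 1) / b) q p N = Y5 at *
  generalize ellFac (a * q ^ (2 * j + 1) / c) q p N = Y6 at *
  generalize ellFac (c / (a * q ^ n)) q p N = Y7 at *
  generalize ellFac (b / (a * q ^ n)) q p N = Y8 at *
  generalize (a / m) ^ (2 * j) = Z at *
  trans (X1 * X6 * X11 * X12 / (X2 * X4 * X13 * X14)) *
    ((X8 * X16) * (Y7 * X7 * (Y8 * X3)) / (X10 * X16 * (Y3 * Y6 * (Y4 * Y5))))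
  · simp only [mul_div_assoc', div_mul_eq_mul_div, div_div, div_div_eq_mul_div]
    rw [div_eq_div_iff (by simp [*]) (by simp [*])]
    ring
  · rw [hR23, ← hR1]
    simp only [mul_div_assoc', div_mul_eq_mul_div, div_div]
    rw [div_eq_div_iff (by simp [*]) (by simp [*])]
    ring

/-- The summand of the double series: the left-hand terms expanded by the Frenkel–Turaev sum. -/
theorem quadTerm_mul_ftTerm (hp : ‖p‖ < 1) (hq : q ≠ 0) (ha : a ≠ 0) (hb : b ≠ 0)
    (hc : c ≠ 0) (hk : k ≠ 0) (hm : m = b * c * k / (a * q)) (g : QuadGeneric a b c k m q p)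
    (hqn : ∀ i < n, theta (q * q ^ i) p ≠ 0)
    {j N i : ℕ} (hn : n = N + 2 * j) (hi : i ≤ N) :
    quadTerm n a b c k m q p j * ftTerm N (m * q ^ (4 * j)) (b * q ^ (2 * j)) (c * q ^ (2 * j))
        (k * q ^ (n + 2 * j)) (m / a) q p i =
      outerTerm n a b c k m q p (2 * j + i) * innerTerm a m q p (2 * j + i) j *
      (ellFac (a * q) q p (4 * j) / ellFac (m * q) q p (4 * j) * (a / m) ^ (2 * j) *
        (ellFac (m * q / b) q p (2 * j) * ellFac (m * q / c) q p (2 * j) *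
          ellFac (m * q / (k * q ^ n)) q p (2 * j) * ellFac (m * q ^ (n + 1)) q p (2 * j)) /
        (ellFac (a * q / b) q p (2 * j) * ellFac (a * q / c) q p (2 * j) *
          ellFac (a * q / (k * q ^ n)) q p (2 * j) * ellFac (a * q ^ (n + 1)) q p (2 * j))) := by
  have hm0 : m ≠ 0 := hm ▸ by positivity
  have hfac : ∀ {x y : ℂ}, ThetaGeneric q p x → ∀ i : ℤ, x * q ^ i = y → ∀ n,
    ellFac y q p n ≠ 0 := fun h i hy n => h.ellFac_ne_zero hq i hy n
  have gam : ThetaGeneric q p (a / m) := g.gma.inv hp hq (div_ne_zero hm0 ha) (inv_div _ _)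
  obtain ⟨s, hs⟩ : ∃ s, s = 2 * j + i := ⟨_, rfl⟩
  have hs' : s = i + 2 * j := by rw [hs, add_comm]
  have split : ∀ x y : ℂ, x * q ^ (2 * j) = y →
      ellFac x q p s = ellFac x q p (2 * j) * ellFac y q p i := fun x y h => by
    rw [hs, ellFac_add i h]
  have split' : ∀ x y : ℂ, x * q ^ i = y →
      ellFac x q p s = ellFac x q p i * ellFac y q p (2 * j) := fun x y h => by
    rw [hs', ellFac_add (2 * j) h]
  -- As `s + 2j = 4j + i`, the factorials of lengths `s` and `2j` concatenate, and can be cut again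
  -- at `4j`.
  have s1 : ellFac m q p s * ellFac (m * q ^ s) q p (2 * j) * theta (m * q ^ (4 * j)) p =
      theta m p * ellFac (m * q) q p (4 * j) * ellFac (m * q ^ (4 * j)) q p i := by
    rw [← ellFac_succ' (4 * j) rfl, ellFac_succ rfl, ← ellFac_add (2 * j) rfl,
      show s + 2 * j = 4 * j + i by omega, ellFac_add i rfl]
    ring
  have s2 : ellFac (a * q) q p s * ellFac (a * q ^ (s + 1)) q p (2 * j) =
      ellFac (a * q) q p (4 * j) * ellFac (m * q ^ (4 * j) * q / (m / a)) q p i := by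
    rw [← ellFac_add (2 * j) (by ring), show s + 2 * j = 4 * j + i by omega,
      ellFac_add (y := m * q ^ (4 * j) * q / (m / a)) i (by field_simp)]
  have s3 := split' (m / a) (m * q ^ i / a) (by ring)
  have s4 := split' q (q ^ (i + 1)) (by ring)
  have s5 := split b _ rfl
  have s6 := split c _ rfl
  have s7 := split (k * q ^ n) (k * q ^ (n + 2 * j)) (by ring)
  have s8 := split (q ^ n)⁻¹ (q ^ N)⁻¹ (by rw [hn, pow_add]; field_simp)
  have s9 := split (m * q / b) (m * q ^ (4 * j) * q / (b * q ^ (2 * j))) (by field_simp; ring)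
  have s10 := split (m * q / c) (m * q ^ (4 * j) * q / (c * q ^ (2 * j))) (by field_simp; ring)
  have s11 := split (m * q / (k * q ^ n)) (m * q ^ (4 * j) * q / (k * q ^ (n + 2 * j)))
    (by rw [pow_add]; field_simp; ring)
  have s12 := split (m * q ^ (n + 1)) (m * q ^ (4 * j) * q ^ (N + 1)) (by rw [hn]; ring)
  -- The factorials of length `2j` with parameters `m q^i/a` and `q^(i+1)` come from enlarging `i`
  -- to `s`. Reversal turns them into the `s`-dependent factors of `innerTerm`.
  have r1 := ellFac_reverse (q := q) (x := m * q ^ i / a) (y := q ^ (i + 1))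
    (x' := a * q / (m * q ^ s)) (y' := (q ^ s)⁻¹) (l := 2 * j) hp hq (by positivity)
    (by positivity) (by rw [hs', pow_add]; field_simp) (by rw [hs']; field_simp; ring)
  have hpow : (m * q ^ i / a) ^ (2 * j) * (a / m) ^ (2 * j) * q ^ (2 * j) =
      (q ^ (i + 1)) ^ (2 * j) := by
    rw [← mul_pow, ← mul_pow]
    congr 1
    field_simp
    try ring
  have nq : ellFac q q p s ≠ 0 := ellFac_ne_zero fun l hl => hqn l (by omega)
  have n1 : theta (m * q ^ (4 * j)) p ≠ 0 := g.gm.theta_ne_zero (4 * j : ℕ) (by norm_cast)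
  have n2 : theta m p ≠ 0 := g.gm.theta_ne_zero 0 (by simp)
  have n3 : theta a p ≠ 0 := g.ga.theta_ne_zero 0 (by simp)
  have n4 : ellFac (m * q) q p (4 * j) ≠ 0 := hfac g.gm 1 (by simp) _
  have n5 : ellFac (a * q) q p s ≠ 0 := hfac g.ga 1 (by simp) _
  have n6 : ellFac (a * q ^ (s + 1)) q p (2 * j) ≠ 0 := hfac g.ga (s + 1 : ℕ) (by norm_cast) _
  have n7 : ellFac (a * q / (m * q ^ s)) q p (2 * j) ≠ 0 :=
    hfac gam (1 - (s : ℤ)) (by rw [zpow_sub₀ hq, zpow_natCast]; field_simp) _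
  have n8 : ellFac (m * q ^ i / a) q p (2 * j) ≠ 0 := hfac g.gma i (by rw [zpow_natCast]; ring) _
  have n9 : ellFac (a * q) q p (4 * j) ≠ 0 := hfac g.ga 1 (by simp) _
  have n10 : ellFac (q ^ 2) (q ^ 2) p j ≠ 0 := ellFac_ne_zero fun l hl => by
    have := hqn (2 * l + 1) (by omega)
    rwa [show q * q ^ (2 * l + 1) = q ^ 2 * (q ^ 2) ^ l by ring] at this
  have n11 : ellFac (m ^ 2 * q ^ 2 / a) (q ^ 2) p j ≠ 0 :=
    (g.gmma.sq (y := m ^ 2 * q ^ 2 / a) hq 2 (by norm_cast; ring)).ellFac_ne_zero (pow_ne_zero 2 hq) 0 (by simp) j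
  have gab : ThetaGeneric q p (a / b) := g.gba.inv hp hq (div_ne_zero hb ha) (inv_div _ _)
  have gac : ThetaGeneric q p (a / c) := g.gca.inv hp hq (div_ne_zero hc ha) (inv_div _ _)
  have gak : ThetaGeneric q p (a / k) := g.gka.inv hp hq (div_ne_zero hk ha) (inv_div _ _)
  have n12 : ellFac (a * q / b) q p (2 * j) ≠ 0 := hfac gab 1 (by rw [zpow_one]; ring) _
  have n13 : ellFac (a * q / c) q p (2 * j) ≠ 0 := hfac gac 1 (by rw [zpow_one]; ring) _
  have n14 : ellFac (a * q / (k * q ^ n)) q p (2 * j) ≠ 0 :=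
    hfac gak (1 - (n : ℕ)) (by rw [zpow_sub₀ hq, zpow_natCast]; field_simp) _
  have n15 : ellFac (a * q ^ (n + 1)) q p (2 * j) ≠ 0 := hfac g.ga (n + 1 : ℕ) (by norm_cast) _
  have n16 : ellFac (m * q / b) q p s ≠ 0 := hfac g.gmb 1 (by rw [zpow_one]; ring) _
  have n17 : ellFac (m * q / c) q p s ≠ 0 := hfac g.gmc 1 (by rw [zpow_one]; ring) _
  have n18 : ellFac (m * q / (k * q ^ n)) q p s ≠ 0 :=
    hfac g.gmk (1 - (n : ℕ)) (by rw [zpow_sub₀ hq, zpow_natCast]; field_simp) _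
  have n19 : ellFac (m * q ^ (n + 1)) q p s ≠ 0 := hfac g.gm (n + 1 : ℕ) (by norm_cast) _
  have n20 : (m * q ^ i / a) ^ (2 * j) ≠ 0 := by positivity
  have hR : ellFac (m * q ^ i / a) q p (2 * j) * ellFac (q ^ s)⁻¹ q p (2 * j) *
      ((a / m) ^ (2 * j) * q ^ (2 * j)) =
      ellFac (q ^ (i + 1)) q p (2 * j) * ellFac (a * q / (m * q ^ s)) q p (2 * j) := by
    apply mul_right_cancel₀ n20
    rw [← r1, ← hpow]
    ring
  have hθ : theta (m * q ^ (4 * j) * q ^ (2 * i)) p = theta (m * q ^ (2 * s)) p := by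
    rw [hs]
    congr 1
    ring
  rw [s4] at nq
  rw [s9] at n16
  rw [s10] at n17
  rw [s11] at n18
  rw [s12] at n19
  have e1 : ellFac (m * q ^ (4 * j)) q p i = ellFac m q p s * ellFac (m * q ^ s) q p (2 * j) *
      theta (m * q ^ (4 * j)) p / (theta m p * ellFac (m * q) q p (4 * j)) := by
    rw [eq_div_iff (mul_ne_zero n2 n4), s1]
    ring
  have e2 : ellFac (m * q ^ (4 * j) * q / (m / a)) q p i = ellFac (a * q) q p s *
      ellFac (a * q ^ (s + 1)) q p (2 * j) / ellFac (a * q) q p (4 * j) := by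
    rw [eq_div_iff n9, s2]
    ring
  rw [← hs, quadTerm, ftTerm, outerTerm, innerTerm, s3, s4, s5, s6, s7, s8, s9, s10, s11, s12, hθ,
    e1, e2]
  obtain ⟨q1, q2⟩ := mul_ne_zero_iff.1 nq
  obtain ⟨b1, b2⟩ := mul_ne_zero_iff.1 n16
  obtain ⟨c1, c2⟩ := mul_ne_zero_iff.1 n17
  obtain ⟨k1, k2⟩ := mul_ne_zero_iff.1 n18
  obtain ⟨l1, l2⟩ := mul_ne_zero_iff.1 n19
  clear s1 s2 s3 s4 s5 s6 s7 s8 s9 s10 s11 s12 e1 e2 split split' hfac r1 hpow n20 n16 n17 n18 n19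
    g gam gab gac gak hqn hθ nq
  generalize theta (a * q ^ (4 * j)) p = T1 at *
  generalize theta a p = T2 at *
  generalize theta (m * q ^ (2 * s)) p = T3 at *
  generalize theta (m * q ^ (4 * j)) p = T4 at *
  generalize theta m p = T5 at *
  generalize ellFac a (q ^ 2) p j = A1 at *
  generalize ellFac (a ^ 2 / m ^ 2) (q ^ 2) p j = A2 at *
  generalize ellFac (q ^ 2) (q ^ 2) p j = D1 at *
  generalize ellFac (m ^ 2 * q ^ 2 / a) (q ^ 2) p j = D2 at *
  generalize ellFac b q p (2 * j) = B1 at *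
  generalize ellFac c q p (2 * j) = B2 at *
  generalize ellFac (k * q ^ n) q p (2 * j) = B3 at *
  generalize ellFac (q ^ n)⁻¹ q p (2 * j) = B4 at *
  generalize ellFac (a * q / b) q p (2 * j) = E1 at *
  generalize ellFac (a * q / c) q p (2 * j) = E2 at *
  generalize ellFac (a * q / (k * q ^ n)) q p (2 * j) = E3 at *
  generalize ellFac (a * q ^ (n + 1)) q p (2 * j) = E4 at *
  generalize ellFac (b * q ^ (2 * j)) q p i = F1 at *
  generalize ellFac (c * q ^ (2 * j)) q p i = F2 at *
  generalize ellFac (k * q ^ (n + 2 * j)) q p i = F3 at *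
  generalize ellFac (q ^ N)⁻¹ q p i = F4 at *
  generalize ellFac (m / a) q p i = F5 at *
  generalize ellFac q q p i = G5 at *
  generalize ellFac (m * q ^ (4 * j) * q / (b * q ^ (2 * j))) q p i = G1 at *
  generalize ellFac (m * q ^ (4 * j) * q / (c * q ^ (2 * j))) q p i = G2 at *
  generalize ellFac (m * q ^ (4 * j) * q / (k * q ^ (n + 2 * j))) q p i = G3 at *
  generalize ellFac (m * q ^ (4 * j) * q ^ (N + 1)) q p i = G4 at *
  generalize ellFac (m * q / b) q p (2 * j) = H1 at *
  generalize ellFac (m * q / c) q p (2 * j) = H2 at *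
  generalize ellFac (m * q / (k * q ^ n)) q p (2 * j) = H3 at *
  generalize ellFac (m * q ^ (n + 1)) q p (2 * j) = H4 at *
  generalize ellFac (m * q ^ i / a) q p (2 * j) = U at *
  generalize ellFac (q ^ (i + 1)) q p (2 * j) = W at *
  generalize ellFac (q ^ s)⁻¹ q p (2 * j) = Q at *
  generalize ellFac (a * q / (m * q ^ s)) q p (2 * j) = R at *
  generalize ellFac m q p s = M1 at *
  generalize ellFac (m * q ^ s) q p (2 * j) = M2 at *
  generalize ellFac (a * q) q p s = N1 at *
  generalize ellFac (a * q ^ (s + 1)) q p (2 * j) = N2 at *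
  generalize ellFac (m * q) q p (4 * j) = X2 at *
  generalize ellFac (a * q) q p (4 * j) = X1 at *
  generalize (a / m) ^ (2 * j) = Z at *
  rw [show q ^ s = q ^ (2 * j) * q ^ i by rw [hs, pow_add]]
  generalize q ^ (2 * j) = Y at *
  generalize q ^ i = V at *
  obtain ⟨K, hK⟩ : ∃ K, K = T1 * T3 * A1 * A2 * B1 * B2 * B3 * B4 * Y * V * M1 * M2 * F1 * F2 * F3 *
      F4 * F5 * X1 / (T2 * T5 * D1 * D2 * E1 * E2 * E3 * E4 * X2 * G1 * G2 * G3 * G4 * G5 * N1 * N2 *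
      (W * R)) := ⟨_, rfl⟩
  trans K * (W * R)
  · rw [hK]
    clear hK hR
    simp only [mul_div_assoc', div_mul_eq_mul_div, div_div, div_div_eq_mul_div]
    rw [div_eq_div_iff (by simp [*]) (by simp [*])]
    ring
  · rw [← hR, hK]
    clear hK hR
    simp only [mul_div_assoc', div_mul_eq_mul_div, div_div]
    rw [div_eq_div_iff (by simp [*]) (by simp [*])]
    ring

/-- The quadratic transformation for generic parameters. -/
theorem sum_quadTerm (hp0 : p ≠ 0) (hp : ‖p‖ < 1) (hq : q ≠ 0) (ha : a ≠ 0) (hb : b ≠ 0)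
    (hc : c ≠ 0) (hk : k ≠ 0) (hm : m = b * c * k / (a * q)) (g : QuadGeneric a b c k m q p)
    (hqn : ∀ i < n, theta (q * q ^ i) p ≠ 0) :
    ∑ j ∈ Finset.range (n / 2 + 1), quadTerm n a b c k m q p j =
      quadPrefactor n a b c k m q p *
        ∑ s ∈ Finset.range (n + 1), outerTerm n a b c k m q p s * innerSum a m q p s := by
  have hm0 : m ≠ 0 := hm ▸ by positivity
  have hexp : ∀ j ∈ Finset.range (n / 2 + 1), quadTerm n a b c k m q p j =
      ∑ s ∈ Finset.Icc (2 * j) n, quadPrefactor n a b c k m q p *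
        (outerTerm n a b c k m q p s * innerTerm a m q p s j) := fun j hj => by
    have hj : 2 * j ≤ n := by have := Finset.mem_range_succ_iff.1 hj; omega
    obtain ⟨N, hN⟩ : ∃ N, n = N + 2 * j := ⟨n - 2 * j, by omega⟩
    have gz : ∀ {x y : ℂ}, ThetaGeneric q p x → ∀ i : ℤ, x * q ^ i = y → ThetaGeneric q p y :=
      fun h i hy => h.of_eq hq i hy
    have hsum := sum_ftTerm (N := N) (a := m * q ^ (4 * j)) (b := b * q ^ (2 * j))
      (c := c * q ^ (2 * j)) (d := k * q ^ (n + 2 * j)) (e := m / a) hp0 hp hq (by positivity)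
      (by positivity) (by positivity) (by positivity)
      (by rw [hm, hN]; field_simp; ring)
      (fun i hi => hqn i (by omega)) (gz g.gm (4 * j : ℕ) (by norm_cast))
      (gz g.gmb (2 * j : ℕ) (by rw [zpow_natCast]; field_simp; ring))
      (gz g.gmc (2 * j : ℕ) (by rw [zpow_natCast]; field_simp; ring))
      (gz g.gmk (2 * j - n : ℤ) (by
        rw [zpow_sub₀ hq, zpow_natCast, pow_add]; norm_cast; field_simp; ring))
      (gz (g.ga.inv hp hq ha rfl) (-(2 * j + n + 1 : ℕ)) (by
        rw [zpow_neg, zpow_natCast, hm]; field_simp; ring))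
      (gz g.ga (4 * j : ℕ) (by rw [zpow_natCast]; field_simp))
    have hpre := quadPrefactor_mul_ftSum hp hq ha hb hc hk hm g hN
    obtain ⟨S, hS⟩ : ∃ S, S = ftSum N (m * q ^ (4 * j)) (b * q ^ (2 * j)) (c * q ^ (2 * j))
      (k * q ^ (n + 2 * j)) q p := ⟨_, rfl⟩
    -- The numerator of the closed form involves `k/a`, `c/a`, `b/a` up to powers of `q`, which is
    -- where those three genericity conditions enter.
    have hS0 : S ≠ 0 := by
      have hfac : ∀ {x y : ℂ}, ThetaGeneric q p x → ∀ i : ℤ, x * q ^ i = y → ∀ n,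
        ellFac y q p n ≠ 0 := fun h i hy n => h.ellFac_ne_zero hq i hy n
      have n1 : ellFac (m * q ^ (4 * j) * q) q p N ≠ 0 :=
        hfac g.gm (4 * j + 1 : ℕ) (by rw [zpow_natCast]; ring) _
      have n2 : ellFac (m * q ^ (4 * j) * q / (b * q ^ (2 * j) * (c * q ^ (2 * j)))) q p N ≠ 0 :=
        hfac g.gka 0 (by rw [zpow_zero, hm]; field_simp; ring) _
      have n3 : ellFac (m * q ^ (4 * j) * q / (b * q ^ (2 * j) * (k * q ^ (n + 2 * j)))) q p N ≠ 0 :=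
        hfac g.gca (-n) (by rw [zpow_neg, zpow_natCast, hm, pow_add]; field_simp; ring) _
      have n4 : ellFac (m * q ^ (4 * j) * q / (c * q ^ (2 * j) * (k * q ^ (n + 2 * j)))) q p N ≠ 0 :=
        hfac g.gba (-n) (by rw [zpow_neg, zpow_natCast, hm, pow_add]; field_simp; ring) _
      have n5 : ellFac (m * q ^ (4 * j) * q / (b * q ^ (2 * j))) q p N ≠ 0 :=
        hfac g.gmb (2 * j + 1 : ℕ) (by rw [zpow_natCast]; field_simp; ring) _
      have n6 : ellFac (m * q ^ (4 * j) * q / (c * q ^ (2 * j))) q p N ≠ 0 :=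
        hfac g.gmc (2 * j + 1 : ℕ) (by rw [zpow_natCast]; field_simp; ring) _
      have n7 : ellFac (m * q ^ (4 * j) * q / (k * q ^ (n + 2 * j))) q p N ≠ 0 :=
        hfac g.gmk (2 * j + 1 - n : ℤ) (by
          rw [zpow_sub₀ hq, zpow_natCast, pow_add]; norm_cast; field_simp; ring) _
      have n8 : ellFac (m * q ^ (4 * j) * q /
          (b * q ^ (2 * j) * (c * q ^ (2 * j)) * (k * q ^ (n + 2 * j)))) q p N ≠ 0 :=
        hfac (g.ga.inv hp hq ha rfl) (-(n + 2 * j : ℕ)) (by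
          rw [zpow_neg, zpow_natCast, hm]; field_simp; ring) _
      rw [hS, ftSum]
      exact div_ne_zero (by simp only [ne_eq, mul_eq_zero, not_or]; exact ⟨⟨⟨n1, n2⟩, n3⟩, n4⟩)
        (by simp only [ne_eq, mul_eq_zero, not_or]; exact ⟨⟨⟨n5, n6⟩, n7⟩, n8⟩)
    rw [← hS] at hsum hpre
    apply mul_right_cancel₀ hS0
    rw [← hsum, Finset.mul_sum, hsum, Finset.sum_mul]
    -- The inner index `i ≤ N = n - 2j` becomes the outer index `s = 2j + i`.
    have hIcc : Finset.Icc (2 * j) n = (Finset.range (N + 1)).map (addLeftEmbedding (2 * j)) := by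
      ext s
      simp only [Finset.mem_Icc, Finset.mem_map, Finset.mem_range, addLeftEmbedding_apply]
      constructor
      · rintro ⟨h1, h2⟩
        exact ⟨s - 2 * j, by omega, by omega⟩
      · rintro ⟨i, hi, rfl⟩
        omega
    rw [hIcc, Finset.sum_map]
    refine Finset.sum_congr rfl fun i hi => ?_
    rw [quadTerm_mul_ftTerm hp hq ha hb hc hk hm g hqn hN (Finset.mem_range_succ_iff.1 hi), ← hpre,
      addLeftEmbedding_apply]
    ring
  rw [Finset.sum_congr rfl hexp, Finset.mul_sum]
  -- The region `2j ≤ s ≤ n` is read for fixed `s` as `j ≤ s/2`.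
  rw [Finset.sum_comm' (t' := Finset.range (n + 1)) (s' := fun s => Finset.range (s / 2 + 1))
    (fun j s => by simp only [Finset.mem_range, Finset.mem_Icc]; omega)]
  refine Finset.sum_congr rfl fun s hs => ?_
  have hs := Finset.mem_range_succ_iff.1 hs
  rw [← sum_innerTerm hp0 hp hq ha hm0 (fun i hi => hqn i (by omega)) g.ga g.gma g.gmma,
    Finset.mul_sum, Finset.mul_sum]

end

/-! ### Passage to the very-well-poised series and removal of the genericity assumptions -/

/-- The general term of the very-well-poised series `V`. -/
noncomputable def vTerm (a : ℂ) (l : List ℂ) (q p : ℂ) (k : ℕ) : ℂ :=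
  theta (a * q ^ (2 * k)) p / theta a p *
    (ellFacs (a :: l) q p k * q ^ k / seriesDenom a l q p k)

theorem ellFac_eq_zero {x q p : ℂ} (hp : ‖p‖ < 1) {j k : ℕ} (hj : x * q ^ j = 1) (hjk : j < k) :
    ellFac x q p k = 0 :=
  Finset.prod_eq_zero (Finset.mem_range.2 hjk) (by rw [hj, theta_one hp])

theorem V_eq_sum {a x q p : ℂ} {l : List ℂ} {N : ℕ} (hx : x ∈ l)
    (h : ∀ k, N < k → ellFac x q p k = 0) :
    V a l q p = ∑ k ∈ Finset.range (N + 1), vTerm a l q p k := by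
  rw [V, tsum_eq_sum (s := Finset.range (N + 1))]
  · rfl
  · intro k hk
    have : ellFacs (a :: l) q p k = 0 :=
      List.prod_eq_zero (List.mem_map.2 ⟨x, List.mem_cons_of_mem _ hx, h k (by simp at hk; omega)⟩)
    rw [this]
    simp

/-- Each pair of parameters `x, xq` in base `q²` merges into one factorial of length `2j` in base
`q`; the corresponding denominators merge likewise. -/
theorem vTerm_eq_quadTerm {n : ℕ} {a b c k m q p : ℂ} (hq : q ≠ 0) (ha : a ≠ 0) (hb : b ≠ 0)
    (hc : c ≠ 0) (hk : k ≠ 0) (hm : m ≠ 0) (j : ℕ) :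
    vTerm a [a ^ 2 / m ^ 2, b, b * q, c, c * q, k * q ^ n, k * q ^ (n + 1),
        q ^ (-(n : ℤ)), q ^ (1 - (n : ℤ))] (q ^ 2) p j = quadTerm n a b c k m q p j := by
  have h1 : q ^ (-(n : ℤ)) = (q ^ n)⁻¹ := by rw [zpow_neg, zpow_natCast]
  have h2 : q ^ (1 - (n : ℤ)) = (q ^ n)⁻¹ * q := by
    rw [sub_eq_add_neg, add_comm, zpow_add_one₀ hq, h1]
  simp only [vTerm, quadTerm, ellFacs, seriesDenom, List.map_cons, List.map_nil, List.prod_cons,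
    List.prod_nil, ellFac_two_mul, h1, h2]
  rw [show a * q ^ 2 / (a ^ 2 / m ^ 2) = m ^ 2 * q ^ 2 / a by field_simp,
    show a * (q ^ 2) ^ (2 * j) = a * q ^ (4 * j) by ring,
    show (q ^ 2) ^ j = q ^ (2 * j) by ring,
    show k * q ^ n * q = k * q ^ (n + 1) by ring,
    show a * q ^ 2 / (b * q) = a * q / b by field_simp,
    show a * q ^ 2 / b = a * q / b * q by ring,
    show a * q ^ 2 / (c * q) = a * q / c by field_simp,
    show a * q ^ 2 / c = a * q / c * q by ring,
    show a * q ^ 2 / (k * q ^ (n + 1)) = a * q / (k * q ^ n) by field_simp; ring,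
    show a * q ^ 2 / (k * q ^ n) = a * q / (k * q ^ n) * q by ring,
    show a * q ^ 2 / ((q ^ n)⁻¹ * q) = a * q ^ (n + 1) by field_simp; try ring,
    show a * q ^ 2 / (q ^ n)⁻¹ = a * q ^ (n + 1) * q by field_simp; try ring]
  ring

/-- The four parameters `±d`, `d p^(1/2)`, `-d/p^(1/2)` amount to `d ^ 2` in base `q ^ 2`. -/
theorem ellFac_four {w q p s : ℂ} (hp0 : p ≠ 0) (hp : ‖p‖ < 1) (hq : q ≠ 0) (hw : w ≠ 0)
    (hs : s ^ 2 = p) (l : ℕ) :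
    ellFac w q p l * ellFac (-w) q p l * ellFac (w * s) q p l * ellFac (-w / s) q p l =
      ellFac (w ^ 2) (q ^ 2) p l * ∏ i ∈ Finset.range l, (w * q ^ i / s) := by
  have hs0 : s ≠ 0 := by
    rintro rfl
    exact hp0 (by rw [← hs]; simp)
  simp only [ellFac, ← Finset.prod_mul_distrib]
  refine Finset.prod_congr rfl fun i _ => ?_
  have hz : w * q ^ i ≠ 0 := mul_ne_zero hw (pow_ne_zero _ hq)
  have h1 := theta_sq hz hs0 hp hs
  -- The last parameter is `-w/s` and not `-w s`. The two arguments differ by the nome `p = s²`, and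
  -- this quasi-period shift creates the factor `w q^i/s`.
  have h2 := theta_mul_nome (z := -(w * q ^ i) / s) (div_ne_zero (neg_ne_zero.2 hz) hs0) hp0 hp
  rw [show p * (-(w * q ^ i) / s) = -(w * q ^ i * s) by rw [← hs]; field_simp] at h2
  rw [show w ^ 2 * (q ^ 2) ^ i = (w * q ^ i) ^ 2 by ring, h1, h2,
    show -w * q ^ i = -(w * q ^ i) by ring, show w * s * q ^ i = w * q ^ i * s by ring,
    show -w / s * q ^ i = -(w * q ^ i) / s by ring]
  generalize w * q ^ i = z at *
  field_simp

/-- The four parameters built from `d` amount to `d² = m²q/a` in base `q²`, and their four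
denominators to `v² = aq` with `v = -mq/d`. The leftover monomials have ratio `d/v = -m/a` in each
factor. This is `innerSum`, whose factors `(aq)_l/(m/a)_l` cancel against `outerTerm`. -/
theorem vTerm_eq_outerTerm_mul {n : ℕ} {a b c d k m q p s : ℂ} (hp0 : p ≠ 0) (hp : ‖p‖ < 1)
    (hq : q ≠ 0) (ha : a ≠ 0) (hm : m ≠ 0) (hs : s ^ 2 = p)
    (hd : d ^ 2 = m ^ 2 * q / a) (gA : ThetaGeneric q p a) (gma : ThetaGeneric q p (m / a)) (l : ℕ) :
    vTerm m [a / m, d, -d, d * s, -d / s, b, c, k * q ^ n, q ^ (-(n : ℤ))] q p l =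
      outerTerm n a b c k m q p l * innerSum a m q p l := by
  have hs0 : s ≠ 0 := by
    rintro rfl
    exact hp0 (by rw [← hs]; simp)
  have hd0 : d ≠ 0 := by
    rintro rfl
    have : m ^ 2 * q / a ≠ 0 := by positivity
    exact this (by rw [← hd]; simp)
  have hv0 : -(m * q / d) ≠ 0 := neg_ne_zero.2 (by positivity)
  have f1 := ellFac_four hp0 hp hq hd0 hs l
  have f2 := ellFac_four hp0 hp hq hv0 hs l
  have hv : (-(m * q / d)) ^ 2 = a * q := by
    rw [neg_sq, div_pow, hd]
    field_simp
  have hratio : ∏ i ∈ Finset.range l, (d * q ^ i / s) =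
      (-(m / a)) ^ l * ∏ i ∈ Finset.range l, (-(m * q / d) * q ^ i / s) := by
    have : (-(m / a)) ^ l = ∏ _i ∈ Finset.range l, (-(m / a)) := by simp
    rw [this, ← Finset.prod_mul_distrib]
    refine Finset.prod_congr rfl fun i _ => ?_
    have : d = m / a * (m * q / d) := by
      field_simp
      rw [hd]
      field_simp
    nth_rw 1 [this]
    ring
  have hprod : ∏ i ∈ Finset.range l, (-(m * q / d) * q ^ i / s) ≠ 0 :=
    Finset.prod_ne_zero_iff.2 fun i _ => div_ne_zero (mul_ne_zero hv0 (pow_ne_zero _ hq)) hs0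
  have n1 : ellFac (a * q) q p l ≠ 0 := gA.ellFac_ne_zero hq 1 (by simp) l
  have n2 : ellFac (m / a) q p l ≠ 0 := gma.ellFac_ne_zero hq 0 (by simp) l
  have h1 : q ^ (-(n : ℤ)) = (q ^ n)⁻¹ := by rw [zpow_neg, zpow_natCast]
  rw [hv] at f2
  rw [hd, hratio] at f1
  simp only [vTerm, outerTerm, innerSum, ellFacs, seriesDenom, List.map_cons, List.map_nil,
    List.prod_cons, List.prod_nil, h1]
  rw [show m * q / (a / m) = m ^ 2 * q / a by field_simp,
    show m * q / d = -(-(m * q / d)) by ring,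
    show m * q / (-d) = -(m * q / d) by ring,
    show m * q / (d * s) = -(-(m * q / d)) / s by rw [neg_neg]; field_simp,
    show m * q / (-d / s) = -(m * q / d) * s by field_simp,
    show m * q / (q ^ n)⁻¹ = m * q ^ (n + 1) by field_simp; try ring]
  generalize ∏ i ∈ Finset.range l, (-(m * q / d) * q ^ i / s) = D₀ at *
  generalize -(m * q / d) = v at *
  trans theta (m * q ^ (2 * l)) p / theta m p * (ellFac m q p l * ellFac (a / m) q p l *
    (ellFac d q p l * ellFac (-d) q p l * ellFac (d * s) q p l * ellFac (-d / s) q p l) *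
    ellFac b q p l * ellFac c q p l * ellFac (k * q ^ n) q p l * ellFac (q ^ n)⁻¹ q p l * q ^ l /
    (ellFac q q p l * ellFac (m ^ 2 * q / a) q p l * (ellFac v q p l * ellFac (-v) q p l *
      ellFac (v * s) q p l * ellFac (-v / s) q p l) * ellFac (m * q / b) q p l *
      ellFac (m * q / c) q p l * ellFac (m * q / (k * q ^ n)) q p l *
      ellFac (m * q ^ (n + 1)) q p l))
  · congr 2 <;> ring
  rw [f1, f2]
  generalize (-(m / a)) ^ l = Z at *
  trans theta (m * q ^ (2 * l)) p / theta m p * (ellFac m q p l * ellFac (a / m) q p l *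
    ellFac (m ^ 2 * q / a) (q ^ 2) p l * Z *
    ellFac b q p l * ellFac c q p l * ellFac (k * q ^ n) q p l * ellFac (q ^ n)⁻¹ q p l * q ^ l /
    (ellFac q q p l * ellFac (m ^ 2 * q / a) q p l * ellFac (a * q) (q ^ 2) p l *
      ellFac (m * q / b) q p l *
      ellFac (m * q / c) q p l * ellFac (m * q / (k * q ^ n)) q p l *
      ellFac (m * q ^ (n + 1)) q p l))
  · congr 1
    symm
    rw [← mul_div_mul_right _ _ hprod]
    congr 1 <;> ring
  · symm
    rw [mul_assoc, div_mul_div_comm]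
    congr 1
    symm
    rw [← mul_div_mul_right _ _ (mul_ne_zero n1 n2)]
    congr 1 <;> ring

theorem sum_vTerm_generic {n : ℕ} {a b c d k m q p s : ℂ} (hp0 : p ≠ 0) (hp : ‖p‖ < 1)
    (hq : q ≠ 0) (ha : a ≠ 0) (hb : b ≠ 0) (hc : c ≠ 0) (hk : k ≠ 0)
    (hm : m = b * c * k / (a * q)) (hs : s ^ 2 = p) (hd : d ^ 2 = m ^ 2 * q / a)
    (hqn : ∀ i < n, theta (q * q ^ i) p ≠ 0) (g : QuadGeneric a b c k m q p) :
    ∑ j ∈ Finset.range (n / 2 + 1), vTerm a [a ^ 2 / m ^ 2, b, b * q, c, c * q, k * q ^ n,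
        k * q ^ (n + 1), q ^ (-(n : ℤ)), q ^ (1 - (n : ℤ))] (q ^ 2) p j =
      ellFacs [a * q, k / m, m * q / b, m * q / c] q p n /
          ellFacs [m * q, k / a, a * q / b, a * q / c] q p n *
        ∑ j ∈ Finset.range (n + 1),
          vTerm m [a / m, d, -d, d * s, -d / s, b, c, k * q ^ n, q ^ (-(n : ℤ))] q p j := by
  have hm0 : m ≠ 0 := hm ▸ by positivity
  simp only [vTerm_eq_quadTerm hq ha hb hc hk hm0,
    vTerm_eq_outerTerm_mul hp0 hp hq ha hm0 hs hd g.ga g.gma]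
  rw [sum_quadTerm hp0 hp hq ha hb hc hk hm g hqn]
  congr 1
  simp only [quadPrefactor, ellFacs, List.map_cons, List.map_nil, List.prod_cons, List.prod_nil]
  congr 1 <;> ring

/-! ### Continuity and density of generic parameters -/

theorem continuousAt_ellFac {f : ℂ → ℂ} {y q p : ℂ} (hp : ‖p‖ < 1) (hq : q ≠ 0)
    (hf : ContinuousAt f y) (h0 : f y ≠ 0) (n : ℕ) :
    ContinuousAt (fun t => ellFac (f t) q p n) y := by
  refine tendsto_finsetProd _ fun j _ => ?_
  exact ContinuousAt.comp (g := fun z => theta z p) (f := fun t => f t * q ^ j)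
    (continuousAt_theta (mul_ne_zero h0 (pow_ne_zero _ hq)) hp) (hf.mul continuousAt_const)

theorem continuousAt_ellFacs {l : List (ℂ → ℂ)} {y q p : ℂ} (hp : ‖p‖ < 1) (hq : q ≠ 0)
    (hl : ∀ f ∈ l, ContinuousAt f y ∧ f y ≠ 0) (n : ℕ) :
    ContinuousAt (fun t => ellFacs (l.map fun f => f t) q p n) y := by
  induction l with
  | nil => exact continuousAt_const
  | cons f l ih =>
    have hf := hl f List.mem_cons_self
    exact (continuousAt_ellFac hp hq hf.1 hf.2 n).mul
      (ih fun g hg => hl g (List.mem_cons_of_mem _ hg))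

theorem continuousAt_vTerm {A : ℂ → ℂ} {l : List (ℂ → ℂ)} {y q p : ℂ} (hp : ‖p‖ < 1)
    (hq : q ≠ 0) (hA : ContinuousAt A y) (hA0 : A y ≠ 0)
    (hl : ∀ f ∈ l, ContinuousAt f y ∧ f y ≠ 0) {N k : ℕ} (hk : k ≤ N)
    (hden : TermsDefined (A y) (l.map fun f => f y) q p N) :
    ContinuousAt (fun t => vTerm (A t) (l.map fun f => f t) q p k) y := by
  have hθ : ∀ x : ℂ, x ≠ 0 → ContinuousAt (fun t => theta (A t * x) p) y := fun x hx =>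
    ContinuousAt.comp (g := fun z => theta z p) (f := fun t => A t * x)
      (continuousAt_theta (mul_ne_zero hA0 hx) hp) (hA.mul continuousAt_const)
  have hnum := continuousAt_ellFacs (l := A :: l) hp hq
    (by simpa only [List.forall_mem_cons] using ⟨⟨hA, hA0⟩, hl⟩) k
  have hdenom := continuousAt_ellFacs (l := (fun _ => q) :: l.map fun f t => A t * q / f t) hp hq
    (y := y) (by
      simp only [List.forall_mem_cons, List.forall_mem_map]
      exact ⟨⟨continuousAt_const, hq⟩, fun f hf => ⟨(hA.mul continuousAt_const).div (hl f hf).1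
        (hl f hf).2, div_ne_zero (mul_ne_zero hA0 hq) (hl f hf).2⟩⟩) k
  have hdenom' : ContinuousAt (fun t => seriesDenom (A t) (l.map fun f => f t) q p k) y := by
    simpa only [seriesDenom, List.map_cons, List.map_map, Function.comp_def] using hdenom
  have h1 := hθ 1 one_ne_zero
  simp only [mul_one] at h1
  exact ((hθ _ (pow_ne_zero _ hq)).div h1 hden.1).mul
    ((hnum.mul continuousAt_const).div hdenom' (hden.2 k hk))

/-- Non-genericity means `u t^e q^i = p^l` for some integers `i, l`. Each such equation has at most
one positive real solution because `e ≠ 0`. -/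
theorem countable_not_thetaGeneric {u q p : ℂ} (hp : ‖p‖ < 1) (hq : q ≠ 0)
    (hu : u ≠ 0) {e : ℕ} (he : e ≠ 0) :
    {t : ℝ | 0 < t ∧ ¬ ThetaGeneric q p (u * (t : ℂ) ^ e)}.Countable := by
  refine Set.Countable.mono (s₂ := ⋃ i : ℤ, ⋃ l : ℤ,
    {t : ℝ | 0 < t ∧ u * (t : ℂ) ^ e * q ^ i = p ^ l}) ?_ ?_
  · rintro t ⟨ht, h⟩
    simp only [ThetaGeneric, not_forall, not_not] at h
    obtain ⟨i, hi⟩ := h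
    have ht' : (t : ℂ) ≠ 0 := Complex.ofReal_ne_zero.2 ht.ne'
    obtain ⟨l, hl⟩ := exists_zpow_of_theta_eq_zero (by positivity) hp hi
    exact Set.mem_iUnion.2 ⟨i, Set.mem_iUnion.2 ⟨l, ht, hl⟩⟩
  · refine Set.countable_iUnion fun i => Set.countable_iUnion fun l => Set.Subsingleton.countable ?_
    rintro t ⟨ht, h⟩ t' ⟨ht', h'⟩
    have h2 := h.trans h'.symm
    have h3 : (t : ℂ) ^ e = (t' : ℂ) ^ e :=
      mul_left_cancel₀ hu (mul_right_cancel₀ (zpow_ne_zero i hq) h2)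
    have h4 : t ^ e = t' ^ e := by exact_mod_cast h3
    exact (pow_left_inj₀ ht.le ht'.le he).1 h4

/-- A generic path of parameters through any given ones. -/
theorem exists_filter_quadGeneric {a b c k m q p : ℂ} (hp : ‖p‖ < 1) (hq : q ≠ 0)
    (ha : a ≠ 0) (hb : b ≠ 0) (hc : c ≠ 0) (hk : k ≠ 0) (hm : m ≠ 0) :
    ∃ F : Filter ℂ, F.NeBot ∧ F ≤ 𝓝 1 ∧ ∀ᶠ y in F, y ≠ 0 ∧
      QuadGeneric (a * y ^ 2) (b * y ^ 6) (c * y ^ 6) (k * y ^ 6) (m * y ^ 16) q p := by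
  -- The weights satisfy `16 = 6 + 6 + 6 - 2`, preserving `m = bck/(aq)`. The list records the ten
  -- generic quantities with their weights, which are all nonzero.
  obtain ⟨L, hL⟩ : ∃ L : List (ℂ × ℕ), L = [(a, 2), (m, 16), (m / a, 14), (m ^ 2 / a, 30),
    (m / b, 10), (m / c, 10), (m / k, 10), (b / a, 4), (c / a, 4), (k / a, 4)] := ⟨_, rfl⟩
  have hL0 : ∀ z ∈ L, z.1 ≠ 0 ∧ z.2 ≠ 0 := by
    simp only [hL, List.forall_mem_cons]
    simp [*]
  obtain ⟨S, hS⟩ : ∃ S : Set ℝ, S = ⋃ z ∈ {z | z ∈ L}, {t : ℝ | 0 < t ∧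
    ¬ ThetaGeneric q p (z.1 * (t : ℂ) ^ z.2)} := ⟨_, rfl⟩
  have hSc : S.Countable := hS ▸ Set.Countable.biUnion L.finite_toSet.countable
    fun z hz => countable_not_thetaGeneric hp hq (hL0 z hz).1 (hL0 z hz).2
  -- A countable subset of the line has dense complement, so `1` can be approached through generic
  -- points, even if it is not generic itself.
  have hne : (𝓝[Sᶜ] (1 : ℝ)).NeBot := mem_closure_iff_nhdsWithin_neBot.1 (hSc.dense_compl ℝ 1)
  refine ⟨Filter.map ((↑) : ℝ → ℂ) (𝓝[Sᶜ] 1), hne.map _, ?_, ?_⟩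
  · have : Tendsto ((↑) : ℝ → ℂ) (𝓝 1) (𝓝 ((1 : ℝ) : ℂ)) := Complex.continuous_ofReal.tendsto 1
    rw [Complex.ofReal_one] at this
    exact this.mono_left nhdsWithin_le_nhds
  · rw [eventually_map]
    filter_upwards [self_mem_nhdsWithin, nhdsWithin_le_nhds (lt_mem_nhds one_pos)] with t ht ht0
    have ht' : (t : ℂ) ≠ 0 := Complex.ofReal_ne_zero.2 (ne_of_gt ht0)
    have hg : ∀ z ∈ L, ThetaGeneric q p (z.1 * (t : ℂ) ^ z.2) := fun z hz => by
      by_contra h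
      exact ht (hS ▸ Set.mem_biUnion hz ⟨ht0, h⟩)
    simp only [hL, List.forall_mem_cons] at hg
    obtain ⟨g1, g2, g3, g4, g5, g6, g7, g8, g9, g10, -⟩ := hg
    refine ⟨ht', g1, g2, ?_, ?_, ?_, ?_, ?_, ?_, ?_, ?_⟩
    · convert! g3 using 1; field_simp
    · convert! g4 using 1; field_simp
    · convert! g5 using 1; field_simp
    · convert! g6 using 1; field_simp
    · convert! g7 using 1; field_simp
    · convert! g8 using 1; field_simp
    · convert! g9 using 1; field_simp
    · convert! g10 using 1; field_simp

end EllHyp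

theorem theorem4p2 (n : ℕ) (a b c k q p m d r s : ℂ)
    (ha : a ≠ 0) (hb : b ≠ 0) (hc : c ≠ 0) (hk : k ≠ 0) (hq : q ≠ 0)
    (hp0 : p ≠ 0) (hp1 : ‖p‖ < 1)
    -- `m = bck/aq`
    (hm : m = b * c * k / (a * q))
    -- `r = (q/a)^{1/2}` and `s = p^{1/2}`, for an arbitrary choice of the square roots
    (hr : r ^ 2 = q / a) (hs : s ^ 2 = p)
    (hd : d = m * r ∨ d = -(m * r))
    -- no denominator vanishes in the nonzero terms of the two series and in the prefactor
    (hL : EllHyp.TermsDefined a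
      [a ^ 2 / m ^ 2, b, b * q, c, c * q, k * q ^ n, k * q ^ (n + 1),
        q ^ (-(n : ℤ)), q ^ (1 - (n : ℤ))] (q ^ 2) p (n / 2))
    (hR : EllHyp.TermsDefined m
      [a / m, d, -d, d * s, -d / s, b, c, k * q ^ n, q ^ (-(n : ℤ))] q p n)
    (hP : EllHyp.ellFacs [m * q, k / a, a * q / b, a * q / c] q p n ≠ 0) :
    EllHyp.V a
        [a ^ 2 / m ^ 2, b, b * q, c, c * q, k * q ^ n, k * q ^ (n + 1),
          q ^ (-(n : ℤ)), q ^ (1 - (n : ℤ))] (q ^ 2) p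
      = EllHyp.ellFacs [a * q, k / m, m * q / b, m * q / c] q p n
          / EllHyp.ellFacs [m * q, k / a, a * q / b, a * q / c] q p n
        * EllHyp.V m
            [a / m, d, -d, d * s, -d / s, b, c, k * q ^ n, q ^ (-(n : ℤ))] q p := by
  have hm0 : m ≠ 0 := hm ▸ by positivity
  have hs0 : s ≠ 0 := by
    rintro rfl
    exact hp0 (by rw [← hs]; simp)
  have hd2 : d ^ 2 = m ^ 2 * q / a := by
    have : d ^ 2 = m ^ 2 * r ^ 2 := by rcases hd with rfl | rfl <;> ring
    rw [this, hr]
    ring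
  have hd0 : d ≠ 0 := by
    rintro rfl
    have : m ^ 2 * q / a ≠ 0 := by positivity
    exact this (by rw [← hd2]; simp)
  -- The base `q` is not moved along the path, so the nonvanishing of `(q;q,p)_n` has to come from
  -- the assumed denominators on the right.
  have hqn : ∀ i < n, EllHyp.theta (q * q ^ i) p ≠ 0 := by
    have h := hR.2 n le_rfl
    rw [EllHyp.seriesDenom, EllHyp.ellFacs, List.map_cons, List.prod_cons] at h
    have h' := left_ne_zero_of_mul h
    rw [EllHyp.ellFac, Finset.prod_ne_zero_iff] at h'
    exact fun i hi => h' i (Finset.mem_range.2 hi)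
  have hzero : ∀ k, n < k → EllHyp.ellFac (q ^ (-(n : ℤ))) q p k = 0 := fun k hk =>
    EllHyp.ellFac_eq_zero hp1 (j := n) (by rw [zpow_neg, zpow_natCast]; field_simp) hk
  rw [EllHyp.V_eq_sum (x := q ^ (-(n : ℤ))) (N := n) (by simp) hzero]
  have hVL : EllHyp.V a [a ^ 2 / m ^ 2, b, b * q, c, c * q, k * q ^ n, k * q ^ (n + 1),
      q ^ (-(n : ℤ)), q ^ (1 - (n : ℤ))] (q ^ 2) p = ∑ j ∈ Finset.range (n / 2 + 1),
      EllHyp.vTerm a [a ^ 2 / m ^ 2, b, b * q, c, c * q, k * q ^ n, k * q ^ (n + 1),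
        q ^ (-(n : ℤ)), q ^ (1 - (n : ℤ))] (q ^ 2) p j := by
    -- In base `q²` the series stops at `n/2`, through `q^(-n)` for even `n` and through `q^(1-n)`
    -- for odd `n`.
    rcases Nat.even_or_odd' n with ⟨N, hN | hN⟩
    · refine EllHyp.V_eq_sum (x := q ^ (-(n : ℤ))) (by simp) fun k hk =>
        EllHyp.ellFac_eq_zero hp1 (j := N) ?_ (by omega)
      rw [zpow_neg, zpow_natCast, ← pow_mul, ← hN]
      field_simp
    · refine EllHyp.V_eq_sum (x := q ^ (1 - (n : ℤ))) (by simp) fun k hk =>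
        EllHyp.ellFac_eq_zero hp1 (j := N) ?_ (by omega)
      rw [← pow_mul, ← zpow_natCast q, ← zpow_add₀ hq, hN]
      push_cast
      ring_nf
      simp
  rw [hVL]
  obtain ⟨F, hF, hF1, hgen⟩ :=
    EllHyp.exists_filter_quadGeneric hp1 hq ha hb hc hk hm0
  -- The parameter lists along the path, equal to the given ones at `y = 1`. The weight of `a` is
  -- even so that `d` moves along a monomial: `d² = m²q/a` has weight `2 * 16 - 2 = 30`, hence `d`
  -- has weight `15`.
  let lL : List (ℂ → ℂ) := [fun y => (a * y ^ 2) ^ 2 / (m * y ^ 16) ^ 2, fun y => b * y ^ 6,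
    fun y => b * y ^ 6 * q, fun y => c * y ^ 6, fun y => c * y ^ 6 * q, fun y => k * y ^ 6 * q ^ n,
    fun y => k * y ^ 6 * q ^ (n + 1), fun _ => q ^ (-(n : ℤ)), fun _ => q ^ (1 - (n : ℤ))]
  let lR : List (ℂ → ℂ) := [fun y => a * y ^ 2 / (m * y ^ 16), fun y => d * y ^ 15,
    fun y => -(d * y ^ 15), fun y => d * y ^ 15 * s, fun y => -(d * y ^ 15) / s, fun y => b * y ^ 6,
    fun y => c * y ^ 6, fun y => k * y ^ 6 * q ^ n, fun _ => q ^ (-(n : ℤ))]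
  let lN : List (ℂ → ℂ) := [fun y => a * y ^ 2 * q, fun y => k * y ^ 6 / (m * y ^ 16),
    fun y => m * y ^ 16 * q / (b * y ^ 6), fun y => m * y ^ 16 * q / (c * y ^ 6)]
  let lD : List (ℂ → ℂ) := [fun y => m * y ^ 16 * q, fun y => k * y ^ 6 / (a * y ^ 2),
    fun y => a * y ^ 2 * q / (b * y ^ 6), fun y => a * y ^ 2 * q / (c * y ^ 6)]
  have hq1 : q ^ (-(n : ℤ)) ≠ 0 := zpow_ne_zero _ hq
  have hq2 : q ^ (1 - (n : ℤ)) ≠ 0 := zpow_ne_zero _ hq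
  have cL : ∀ f ∈ lL, ContinuousAt f 1 ∧ f 1 ≠ 0 := by
    simp only [lL, List.forall_mem_cons]
    refine ⟨⟨?_, ?_⟩, ⟨?_, ?_⟩, ⟨?_, ?_⟩, ⟨?_, ?_⟩, ⟨?_, ?_⟩, ⟨?_, ?_⟩, ⟨?_, ?_⟩, ⟨?_, ?_⟩,
      ⟨?_, ?_⟩, by simp⟩ <;> first | (fun_prop (disch := simp [*])) | (simp [*])
  have cR : ∀ f ∈ lR, ContinuousAt f 1 ∧ f 1 ≠ 0 := by
    simp only [lR, List.forall_mem_cons]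
    refine ⟨⟨?_, ?_⟩, ⟨?_, ?_⟩, ⟨?_, ?_⟩, ⟨?_, ?_⟩, ⟨?_, ?_⟩, ⟨?_, ?_⟩, ⟨?_, ?_⟩, ⟨?_, ?_⟩,
      ⟨?_, ?_⟩, by simp⟩ <;> first | (fun_prop (disch := simp [*])) | (simp [*])
  have cN : ∀ f ∈ lN, ContinuousAt f 1 ∧ f 1 ≠ 0 := by
    simp only [lN, List.forall_mem_cons]
    refine ⟨⟨?_, ?_⟩, ⟨?_, ?_⟩, ⟨?_, ?_⟩, ⟨?_, ?_⟩, by simp⟩ <;>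
      first | (fun_prop (disch := simp [*])) | (simp [*])
  have cD : ∀ f ∈ lD, ContinuousAt f 1 ∧ f 1 ≠ 0 := by
    simp only [lD, List.forall_mem_cons]
    refine ⟨⟨?_, ?_⟩, ⟨?_, ?_⟩, ⟨?_, ?_⟩, ⟨?_, ?_⟩, by simp⟩ <;>
      first | (fun_prop (disch := simp [*])) | (simp [*])
  have tL : ContinuousAt (fun y => ∑ j ∈ Finset.range (n / 2 + 1),
      EllHyp.vTerm (a * y ^ 2) (lL.map fun f => f y) (q ^ 2) p j) 1 := by
    refine tendsto_finsetSum _ fun j hj => ?_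
    refine EllHyp.continuousAt_vTerm (A := fun y => a * y ^ 2) (N := n / 2) hp1 (pow_ne_zero 2 hq)
      (by fun_prop) (by simpa using ha) cL (Finset.mem_range_succ_iff.1 hj) ?_
    simpa only [lL, List.map_cons, List.map_nil, one_pow, mul_one] using hL
  have tR : ContinuousAt (fun y => ∑ j ∈ Finset.range (n + 1),
      EllHyp.vTerm (m * y ^ 16) (lR.map fun f => f y) q p j) 1 := by
    refine tendsto_finsetSum _ fun j hj => ?_
    refine EllHyp.continuousAt_vTerm (A := fun y => m * y ^ 16) (N := n) hp1 hq
      (by fun_prop) (by simpa using hm0) cR (Finset.mem_range_succ_iff.1 hj) ?_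
    simpa only [lR, List.map_cons, List.map_nil, one_pow, mul_one] using hR
  have tP : ContinuousAt (fun y => EllHyp.ellFacs (lN.map fun f => f y) q p n /
      EllHyp.ellFacs (lD.map fun f => f y) q p n) 1 := by
    refine (EllHyp.continuousAt_ellFacs hp1 hq cN n).div (EllHyp.continuousAt_ellFacs hp1 hq cD n) ?_
    simpa only [lD, List.map_cons, List.map_nil, one_pow, mul_one] using hP
  have heq : (fun y => ∑ j ∈ Finset.range (n / 2 + 1),
      EllHyp.vTerm (a * y ^ 2) (lL.map fun f => f y) (q ^ 2) p j) =ᶠ[F]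
      fun y => EllHyp.ellFacs (lN.map fun f => f y) q p n /
        EllHyp.ellFacs (lD.map fun f => f y) q p n * ∑ j ∈ Finset.range (n + 1),
          EllHyp.vTerm (m * y ^ 16) (lR.map fun f => f y) q p j := by
    filter_upwards [hgen] with y hy
    obtain ⟨hy0, hy⟩ := hy
    exact EllHyp.sum_vTerm_generic hp0 hp1 hq (by positivity) (by positivity) (by positivity)
      (by positivity) (by rw [hm]; field_simp) hs (by rw [mul_pow, hd2]; field_simp) hqn hy
  -- The two sides agree along the generic filter and are continuous at `1`, so their values at `1`
  -- coincide.
  have hlim := tendsto_nhds_unique ((tL.tendsto.mono_left hF1).congr' heq)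
    ((tP.mul tR).tendsto.mono_left hF1)
  simpa only [lL, lR, lN, lD, List.map_cons, List.map_nil, one_pow, mul_one, Pi.mul_apply]
    using hlim
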